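/- Let $X=P(\mathbb R^2)$ be the real projective line with its usual topology and Borel $\sigma$-algebra, on which $PSL(2,\mathbb R)\supset PSL(2,\mathbb Z)$ acts by $\left[\begin{smallmatrix}p&q\\r&s\end{smallmatrix}\right][x:y]=[px+qy:rx+sy]$; the real number $t$ is identified with the point $[t:1]\in X$. Let $\Gamma\subset PSL(2,\mathbb Z)$ be the Farey group, i.e. the subgroup generated by $$a=\begin{bmatrix}1&-2\\1&-1\end{bmatrix},\qquad b=\begin{bmatrix}0&-1\\1&0\end{bmatrix},\qquad c=\begin{bmatrix}1&-1\\2&-1\end{bmatrix}.$$ For $\gamma\in\Gamma$ let $\|\gamma\|$ be the least $n\ge 0$ such that $\gamma=s_1\cdots s_n$ with all $s_i\in\{a,b,c\}$, and let $\Gamma_n=\{\gamma\in\Gamma:\|\gamma\|=n\}$ (a finite set). For $f:X\to\mathbb R$ and $x\in X$ put $S_n(f,x)=\sum_{\gamma\in\Gamma_n}f(\gamma x)$. Let $\mathcal F_0=(0,1)$ and let $\mathcal F_{n+1}$ be obtained from $\mathcal F_n$ by inserting between any two consecutive terms $\frac{p_1}{q_1},\frac{p_2}{q_2}$ (in lowest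 terms) their mediant $\frac{p_1+p_2}{q_1+q_2}$. Let $\mathcal M:[0,1]\to[0,1]$ be Minkowski's question-mark function: $\mathcal M(q)=k/2^n$ if $q$ is the $(k+1)$-th term of $\mathcal F_n$, extended from $\mathbb Q\cap[0,1]$ to $[0,1]$ by continuity and monotonicity, that is, $\mathcal M(x)=\sup\{\mathcal M(q): q\in\mathbb Q\cap[0,1],\ q\le x\}$. For $x\in\mathbb R$, with $n=\lfloor x\rfloor$ and $\{x\}=x-n$, define $$\bar{\mathcal M}(x)=\frac13\Bigl(\sum_{k=-\infty}^{n-1}\frac1{2^{|k|}}+\frac{\mathcal M(\{x\})}{2^{|n|}}\Bigr).$$ This function is increasing; let $\mu_{\bar{\mathcal M}}$, the extended Minkowski measure, be the image on $X$, under $t\mapsto[t:1]$, of the Lebesgue–Stieltjes measure of $\bar{\mathcal M}$ on $\mathbb R$. Theorem. The measure $\mu_{\bar{\mathcal M}}$ is a probability measure on $X$, it satisfies $\mu_{\bar{\mathcal M}}([s,t))=\bar{\mathcal M}(t)-\bar{\mathcal M}(s)$ for all real $s\le t$, and for every $x\in X$ and every continuous $f:X\to\mathbb R$, $$\lim_{n\to\infty}\frac{S_n(f,x)}{|\Gamma_n|}=\int_X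 f\,d\mu_{\bar{\mathcal M}}.$$ -/

import Mathlib

open MeasureTheory Filter Topology
open scoped LinearAlgebra.Projectivization MatrixGroups

namespace Farey

/-! ### The real projective line -/

/-- The real projective line `P(ℝ²)`. -/
abbrev ProjLine : Type := ℙ ℝ (Fin 2 → ℝ)

/-- The usual topology: the quotient topology from `ℝ² ∖ {0}`. -/
noncomputable instance instTopologicalSpaceProjLine : TopologicalSpace ProjLine :=
  TopologicalSpace.coinduced
    (fun v : {v : Fin 2 → ℝ // v ≠ 0} => Projectivization.mk ℝ v.1 v.2) inferInstance

/-- The Borel σ-algebra. -/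
noncomputable instance instMeasurableSpaceProjLine : MeasurableSpace ProjLine := borel ProjLine

instance instBorelSpaceProjLine : BorelSpace ProjLine := ⟨rfl⟩

/-- The embedding of the real line, `t ↦ [t : 1]`; only the point `∞ = [1 : 0]` is missed. -/
noncomputable def ofReal (t : ℝ) : ProjLine :=
  Projectivization.mk ℝ ![t, 1] (fun h => one_ne_zero (congrFun h 1))

/-! ### The Farey group -/

/-- The real projective special linear group, which acts on the projective line by
`[a b; c d] • [x : y] = [a x + b y : c x + d y]`. -/
abbrev PSL2R : Type := Matrix.ProjectiveSpecialLinearGroup (Fin 2) ℝ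

/-- The class of an integral matrix; the image of this map is the subgroup `PSL(2, ℤ)`. -/
def ofInt : SL(2, ℤ) →* PSL2R :=
  (QuotientGroup.mk' (Subgroup.center SL(2, ℝ))).comp
    (Matrix.SpecialLinearGroup.map (Int.castRingHom ℝ))

/-- The matrix of `a`. -/
def matA : SL(2, ℤ) := ⟨!![1, -2; 1, -1], by simp [Matrix.det_fin_two]⟩

/-- The matrix of `b`. -/
def matB : SL(2, ℤ) := ⟨!![0, -1; 1, 0], by simp [Matrix.det_fin_two]⟩

/-- The matrix of `c`. -/
def matC : SL(2, ℤ) := ⟨!![1, -1; 2, -1], by simp [Matrix.det_fin_two]⟩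

/-- The generator `a`. -/
def genA : PSL2R := ofInt matA

/-- The generator `b`. -/
def genB : PSL2R := ofInt matB

/-- The generator `c`. -/
def genC : PSL2R := ofInt matC

/-- The generating set `{a, b, c}`. -/
def gens : Set PSL2R := {genA, genB, genC}

/-- The Farey group. -/
def fareyGroup : Subgroup PSL2R := Subgroup.closure gens

/-- The word norm of `g` with respect to `S`: the least `n` such that `g` is a product of `n`
elements of `S`. -/
noncomputable def wordNorm {G : Type*} [Group G] (S : Set G) (g : G) : ℕ :=
  sInf {n : ℕ | ∃ l : List G, l.length = n ∧ (∀ s ∈ l, s ∈ S) ∧ l.prod = g}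

/-- The sphere of radius `n` of the Farey group. -/
def sphereSet (n : ℕ) : Set PSL2R := {g | g ∈ fareyGroup ∧ wordNorm gens g = n}

theorem ofInt_mul_self (m : SL(2, ℤ)) (h : m * m = -1) : ofInt m * ofInt m = 1 := by
  rw [← map_mul, h]
  refine (QuotientGroup.eq_one_iff _).2 ?_
  rw [Matrix.SpecialLinearGroup.mem_center_iff]
  refine ⟨-1, by norm_num, ?_⟩
  ext i j
  fin_cases i <;> fin_cases j <;> simp [Matrix.scalar]

theorem mul_self_of_mem_gens {s : PSL2R} (hs : s ∈ gens) : s * s = 1 := by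
  rcases hs with rfl | rfl | rfl
  · exact ofInt_mul_self matA (by decide)
  · exact ofInt_mul_self matB (by decide)
  · exact ofInt_mul_self matC (by decide)

/-- Every element of the Farey group is a word in `a`, `b`, `c`. -/
theorem exists_word {g : PSL2R} (hg : g ∈ fareyGroup) :
    ∃ l : List PSL2R, (∀ s ∈ l, s ∈ gens) ∧ l.prod = g := by
  refine Subgroup.closure_induction (p := fun g _ => ∃ l : List PSL2R,
    (∀ s ∈ l, s ∈ gens) ∧ l.prod = g) ?_ ?_ ?_ ?_ hg
  · intro s hs
    exact ⟨[s], by simpa using hs, by simp⟩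
  · exact ⟨[], by simp, by simp⟩
  · rintro x y _ _ ⟨l, hl, rfl⟩ ⟨m, hm, rfl⟩
    refine ⟨l ++ m, ?_, by simp⟩
    intro s hs
    rcases List.mem_append.1 hs with h | h
    · exact hl s h
    · exact hm s h
  · rintro x _ ⟨l, hl, rfl⟩
    refine ⟨l.reverse, fun s hs => hl s (List.mem_reverse.1 hs), ?_⟩
    rw [List.prod_inv_reverse]
    congr 2
    conv_lhs => rw [← List.map_id l]
    refine List.map_congr_left fun s hs => ?_
    exact eq_inv_of_mul_eq_one_left (mul_self_of_mem_gens (hl s hs))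

theorem sphereSet_finite (n : ℕ) : (sphereSet n).Finite := by
  have hg : gens.Finite := Set.toFinite {genA, genB, genC}
  have : Finite gens := hg
  refine ((List.finite_length_eq gens n).image
    (fun l => (l.map Subtype.val).prod)).subset ?_
  rintro g ⟨hg, hn⟩
  obtain ⟨l, hl, hp⟩ := exists_word hg
  have hmem := Nat.sInf_mem (s := {n : ℕ | ∃ l : List PSL2R,
    l.length = n ∧ (∀ s ∈ l, s ∈ gens) ∧ l.prod = g}) ⟨_, l, rfl, hl, hp⟩
  change wordNorm gens g ∈ _ at hmem
  rw [hn] at hmem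
  obtain ⟨m, hm, hs, rfl⟩ := hmem
  refine ⟨m.pmap Subtype.mk hs, by simpa using hm, ?_⟩
  simp [List.map_pmap]

/-- The sphere of radius `n`, as a finite set. -/
noncomputable def sphere (n : ℕ) : Finset PSL2R := (sphereSet_finite n).toFinset

/-- The orbit sum `S_n(f, x) = ∑_{γ ∈ Γ_n} f (γ x)`. -/
noncomputable def orbitSum (n : ℕ) (f : ProjLine → ℝ) (x : ProjLine) : ℝ :=
  ∑ γ ∈ sphere n, f (γ • x)

/-! ### Farey sequences and the question-mark function -/

/-- The mediant `(p₁ + p₂) / (q₁ + q₂)` of two fractions in lowest terms. -/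
def mediant (p q : ℚ) : ℚ := ((p.num + q.num : ℤ) : ℚ) / ((p.den + q.den : ℕ) : ℚ)

/-- Insert the mediant between any two consecutive terms. -/
def insertMediants : List ℚ → List ℚ
  | p :: q :: l => p :: mediant p q :: insertMediants (q :: l)
  | l => l

/-- The Farey sequences: `(0, 1)`, `(0, 1/2, 1)`, `(0, 1/3, 1/2, 2/3, 1)`, … -/
def fareySeq : ℕ → List ℚ
  | 0 => [0, 1]
  | n + 1 => insertMediants (fareySeq n)

/-- `y` is the value of the question-mark function at the rational `q ∈ [0, 1]`: the rational `q`
is the `(k + 1)`-th term of the `n`-th Farey sequence, and `y = k / 2 ^ n`. -/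
def IsQuestionMarkValue (q : ℚ) (y : ℝ) : Prop :=
  ∃ n k : ℕ, (fareySeq n)[k]? = some q ∧ y = (k : ℝ) / 2 ^ n

/-- Minkowski's question-mark function on `[0, 1]`: the increasing extension to the reals of the
function on the rationals, which is increasing and continuous. (Only arguments in `[0, 1]`
matter.) -/
noncomputable def questionMark (x : ℝ) : ℝ :=
  sSup {y : ℝ | ∃ q : ℚ, (q : ℝ) ≤ x ∧ IsQuestionMarkValue q y}

/-- The extension to the whole line,
`x ↦ (1/3) (∑_{k < n} 2^{-|k|} + 2^{-|n|} ?({x}))` with `n = ⌊x⌋`. -/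
noncomputable def extQuestionMark (x : ℝ) : ℝ :=
  (1 / 3) * ((∑' k : {k : ℤ // k < ⌊x⌋}, 1 / (2 : ℝ) ^ (k : ℤ).natAbs)
    + questionMark (Int.fract x) / 2 ^ ⌊x⌋.natAbs)

theorem length_insertMediants (p : ℚ) (l : List ℚ) :
    (insertMediants (p :: l)).length = 2 * l.length + 1 := by
  induction l generalizing p with
  | nil => simp [insertMediants]
  | cons q l ih => simp only [insertMediants, List.length_cons, ih]; ring

theorem length_fareySeq (n : ℕ) : (fareySeq n).length = 2 ^ n + 1 := by
  induction n with
  | zero => simp [fareySeq]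
  | succ n ih =>
    rw [fareySeq]
    cases h : fareySeq n with
    | nil => simp [h] at ih
    | cons p l =>
      rw [h, List.length_cons] at ih
      rw [length_insertMediants, pow_succ]
      omega

theorem IsQuestionMarkValue.mem_Icc {q : ℚ} {y : ℝ} (h : IsQuestionMarkValue q y) :
    y ∈ Set.Icc (0 : ℝ) 1 := by
  obtain ⟨n, k, hk, rfl⟩ := h
  have hlt := (List.getElem?_eq_some_iff.1 hk).1
  rw [length_fareySeq] at hlt
  refine ⟨by positivity, ?_⟩
  rw [div_le_one (by positivity)]
  exact_mod_cast Nat.lt_succ_iff.1 hlt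

theorem questionMark_bddAbove (x : ℝ) :
    BddAbove {y : ℝ | ∃ q : ℚ, (q : ℝ) ≤ x ∧ IsQuestionMarkValue q y} :=
  ⟨1, fun _ ⟨_, _, h⟩ => h.mem_Icc.2⟩

theorem questionMark_nonneg (x : ℝ) : 0 ≤ questionMark x :=
  Real.sSup_nonneg fun _ ⟨_, _, h⟩ => h.mem_Icc.1

theorem questionMark_le_one (x : ℝ) : questionMark x ≤ 1 :=
  Real.sSup_le (fun _ ⟨_, _, h⟩ => h.mem_Icc.2) zero_le_one

theorem questionMark_mono : Monotone questionMark := by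
  intro x y hxy
  refine Real.sSup_le (fun z ⟨q, hq, h⟩ => ?_) (questionMark_nonneg y)
  exact le_csSup (questionMark_bddAbove y) ⟨q, hq.trans hxy, h⟩

theorem summable_weight : Summable fun k : ℤ => 1 / (2 : ℝ) ^ k.natAbs := by
  refine Summable.of_nat_of_neg ?_ ?_ <;>
  · simp only [Int.natAbs_neg, Int.natAbs_natCast]
    simpa using summable_geometric_two

theorem tsum_weight_succ (n : ℤ) :
    (∑' k : {k : ℤ // k < n}, 1 / (2 : ℝ) ^ (k : ℤ).natAbs) + 1 / 2 ^ n.natAbs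
      = ∑' k : {k : ℤ // k < n + 1}, 1 / (2 : ℝ) ^ (k : ℤ).natAbs := by
  have hd : Disjoint (Set.Iio n) {n} := by simp
  have h := (summable_weight.subtype (Set.Iio n)).tsum_union_disjoint hd
    (summable_weight.subtype ({n} : Set ℤ))
  have hu : Set.Iio n ∪ {n} = Set.Iio (n + 1) := by
    ext k; simp only [Set.mem_union, Set.mem_Iio, Set.mem_singleton_iff]; omega
  rw [hu, tsum_singleton n (fun k : ℤ => 1 / (2 : ℝ) ^ k.natAbs)] at h
  exact h.symm

theorem tsum_weight_mono {m n : ℤ} (h : m ≤ n) :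
    (∑' k : {k : ℤ // k < m}, 1 / (2 : ℝ) ^ (k : ℤ).natAbs)
      ≤ ∑' k : {k : ℤ // k < n}, 1 / (2 : ℝ) ^ (k : ℤ).natAbs :=
  Summable.tsum_le_tsum_of_inj
    (fun k : {k : ℤ // k < m} => (⟨k.1, k.2.trans_le h⟩ : {k : ℤ // k < n}))
    (fun a b hab => Subtype.ext (congrArg (fun k : {k : ℤ // k < n} => (k : ℤ)) hab))
    (fun _ _ => by positivity) (fun _ => le_rfl)
    (summable_weight.subtype (Set.Iio m)) (summable_weight.subtype (Set.Iio n))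

theorem extQuestionMark_mono : Monotone extQuestionMark := by
  intro x y hxy
  unfold extQuestionMark
  refine mul_le_mul_of_nonneg_left ?_ (by norm_num)
  rcases (Int.floor_mono hxy).eq_or_lt with h | h
  · rw [h]
    have : Int.fract x ≤ Int.fract y := by
      rw [Int.fract, Int.fract, h]; linarith
    have := questionMark_mono this
    gcongr
  · have h1 := tsum_weight_succ ⌊x⌋
    have h2 := tsum_weight_mono (Int.add_one_le_of_lt h)
    have h3 : questionMark (Int.fract x) / 2 ^ ⌊x⌋.natAbs ≤ 1 / 2 ^ ⌊x⌋.natAbs := by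
      gcongr; exact questionMark_le_one _
    have h4 : 0 ≤ questionMark (Int.fract y) / 2 ^ ⌊y⌋.natAbs :=
      div_nonneg (questionMark_nonneg _) (by positivity)
    linarith

/-- The extended Minkowski measure: the Lebesgue–Stieltjes measure of the extended question-mark
function, carried to the projective line; the point at infinity has measure zero.
(`Monotone.stieltjesFunction` replaces a monotone function by its right limits; the extended
question-mark function is continuous, so nothing is changed.) -/
noncomputable def minkowskiMeasure : Measure ProjLine :=
  (extQuestionMark_mono.stieltjesFunction.measure).map ofReal

end Farey

/-!
The three generators are involutions, and each of them exchanges one of the closed arcs `[0, 1]`,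
`[1, ∞]`, `[∞, 0]` of the projective line with the closure of its complement. Ping-pong on the
open arcs shows that the Farey group is the free product of three groups of order two, so that the
sphere of radius `n + 1` consists of `3 * 2 ^ n` reduced words, split evenly according to the first
letter (`words`, `sum_sphere_succ`, `card_sphere_succ`).

Let `ρ` be the rotation `t ↦ 1 / (1 - t)`, which permutes the three arcs. Reading the arc behind
each letter through a power of `ρ` as a copy of `[0, 1]`, prefixing a letter to a reduced word
amounts to applying one of the two half maps `t ↦ t / (1 + t)` and `t ↦ 1 / (2 - t)`, which map
`[0, 1]` onto `[0, 1/2]` and `[1/2, 1]` (`arcSum_succ`). The point `γ x` lies in the arc behind the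
first letter of `γ` for all but at most three elements of each sphere: whether a half map sends a
point out of `[0, 1]` is decided by the sign of a quadratic form, and a point of `[0, 1]` is never
sent out, any other point by at most one half map (`outside_left_add_outside_right_le`,
`sum_arcSum_outside_le`). Hence the `2 ^ m` Farey intervals of level `m` in each arc receive
asymptotically equal shares of the sphere.

The question-mark function is compatible with the half maps: they turn each Farey sequence into the
two halves of the next one (`fareySeq_succ`), so it takes the values that the maps `y / 2` and
`(1 + y) / 2` prescribe (`FareyValue`), and its extension has the corresponding values on the other
two arcs. Its values are therefore dense in `[0, 1]`, so the extension is continuous, and every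
Farey interval of level `m` has the same measure. Since these intervals shrink with the level
(`wordFun_sub_le`), a continuous function is nearly constant on each of them, and comparing the
orbit sum with the integral interval by interval gives the limit (`abs_arcSum_sub_integral_le`,
`tendsto_arcSum`).
-/

namespace Farey

/-! ### The generators and the half maps -/

theorem ofInt_neg (m : SL(2, ℤ)) : ofInt (-m) = ofInt m := by
  have h : ofInt (-1) = 1 := by
    rw [show (-1 : SL(2, ℤ)) = matB * matB by decide, map_mul]
    exact ofInt_mul_self matB (by decide)
  rw [← neg_one_mul, map_mul, h, one_mul]

theorem ofInt_smul_mk (m : SL(2, ℤ)) (v : Fin 2 → ℝ) (hv : v ≠ 0) :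
    ∃ h, ofInt m • Projectivization.mk ℝ v hv =
      Projectivization.mk ℝ ![(m 0 0 : ℝ) * v 0 + m 0 1 * v 1, m 1 0 * v 0 + m 1 1 * v 1] h := by
  set g : SL(2, ℝ) := Matrix.SpecialLinearGroup.map (Int.castRingHom ℝ) m with hg
  have h1 : ofInt m • Projectivization.mk ℝ v hv =
      Projectivization.mk ℝ (g • v) ((smul_ne_zero_iff_ne g).mpr hv) := rfl
  have h2 : g • v = ![(m 0 0 : ℝ) * v 0 + m 0 1 * v 1, m 1 0 * v 0 + m 1 1 * v 1] := by
    change Matrix.mulVec g.1 v = _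
    ext i
    fin_cases i <;> simp [hg, Matrix.mulVec, dotProduct, Fin.sum_univ_two]
  rw [h1]
  refine ⟨h2 ▸ (smul_ne_zero_iff_ne g).mpr hv, ?_⟩
  congr 1

/-- The rotation `t ↦ 1 / (1 - t)` of order three, which permutes the vertices `0 ↦ 1 ↦ ∞ ↦ 0` of
the basic Farey triangle. It lies in `PSL(2, ℤ)` but not in the Farey group. -/
def matRho : SL(2, ℤ) := ⟨!![0, 1; -1, 1], by simp [Matrix.det_fin_two]⟩

/-- The matrix of `t ↦ t / (1 + t)`, which maps `[0, 1]` onto `[0, 1/2]`. -/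
def matLeft : SL(2, ℤ) := ⟨!![1, 0; 1, 1], by simp [Matrix.det_fin_two]⟩

/-- The matrix of `t ↦ 1 / (2 - t)`, which maps `[0, 1]` onto `[1/2, 1]`. -/
def matRight : SL(2, ℤ) := ⟨!![0, 1; -1, 2], by simp [Matrix.det_fin_two]⟩

/-- The integral matrices of the powers of the rotation. -/
def matRot : Fin 3 → SL(2, ℤ) := ![1, matRho, ⟨!![-1, 1; -1, 0], by simp [Matrix.det_fin_two]⟩]

/-- The rotations which carry `[0, 1]` to the three arcs `[0, 1]`, `[1, ∞]`, `[∞, 0]`. -/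
def rot (i : Fin 3) : PSL2R := ofInt (matRot i)

/-- The three generators, indexed so that `gen i` exchanges the arc `rot i • [0, 1]` with the
closure of its complement. -/
def gen : Fin 3 → PSL2R := ![genC, genA, genB]

/-- The left half map `t ↦ t / (1 + t)`. -/
def leftMap : PSL2R := ofInt matLeft

/-- The right half map `t ↦ 1 / (2 - t)`. -/
def rightMap : PSL2R := ofInt matRight

theorem gen_mul_rot_add_one (i : Fin 3) : gen i * rot (i + 1) = rot i * leftMap := by
  fin_cases i
  · change ofInt _ * ofInt _ = ofInt _ * ofInt _
    rw [← map_mul, ← map_mul]; congr 1; decide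
  · change ofInt _ * ofInt _ = ofInt _ * ofInt _
    rw [← map_mul, ← map_mul]; congr 1; decide
  · change ofInt _ * ofInt _ = ofInt _ * ofInt _
    rw [← map_mul, ← map_mul, ← ofInt_neg]; congr 1; decide

theorem gen_mul_rot_add_two (i : Fin 3) : gen i * rot (i + 2) = rot i * rightMap := by
  fin_cases i
  · change ofInt _ * ofInt _ = ofInt _ * ofInt _
    rw [← map_mul, ← map_mul]; congr 1; decide
  · change ofInt _ * ofInt _ = ofInt _ * ofInt _
    rw [← map_mul, ← map_mul, ← ofInt_neg]; congr 1; decide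
  · change ofInt _ * ofInt _ = ofInt _ * ofInt _
    rw [← map_mul, ← map_mul, ← ofInt_neg]; congr 1; decide

/-- In the rotated coordinates, a letter placed before a word that starts with the next letter in
the cyclic order acts as the left half map. -/
theorem inv_rot_mul_gen_left (i : Fin 3) : (rot i)⁻¹ * gen i = leftMap * (rot (i + 1))⁻¹ := by
  rw [inv_mul_eq_iff_eq_mul, ← mul_assoc, ← gen_mul_rot_add_one, mul_inv_cancel_right]

/-- In the rotated coordinates, a letter placed before a word that starts with the next but one
letter in the cyclic order acts as the right half map. -/
theorem inv_rot_mul_gen_right (i : Fin 3) : (rot i)⁻¹ * gen i = rightMap * (rot (i + 2))⁻¹ := by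
  rw [inv_mul_eq_iff_eq_mul, ← mul_assoc, ← gen_mul_rot_add_two, mul_inv_cancel_right]

theorem gen_mem_gens (i : Fin 3) : gen i ∈ gens := by
  fin_cases i <;> simp [gen, gens]

theorem exists_gen_of_mem_gens {s : PSL2R} (hs : s ∈ gens) : ∃ i, gen i = s := by
  rcases hs with rfl | rfl | rfl
  · exact ⟨1, rfl⟩
  · exact ⟨2, rfl⟩
  · exact ⟨0, rfl⟩

theorem gen_mul_gen (i : Fin 3) : gen i * gen i = 1 := mul_self_of_mem_gens (gen_mem_gens i)

/-! ### The side of a point relative to the unit interval -/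

/-- The sign of the quadratic form `u (v - u)` at `[u : v]`: it is `1` on the open arc `(0, 1)`,
`0` at its two end points and `-1` on the complementary open arc. -/
noncomputable def side : ProjLine → SignType :=
  Projectivization.lift (fun v => SignType.sign (v.1 0 * (v.1 1 - v.1 0))) (by
    rintro ⟨a, ha⟩ ⟨b, hb⟩ t rfl
    have ht : t ≠ 0 := by rintro rfl; simp at ha
    have : (t • b) 0 * ((t • b) 1 - (t • b) 0) = (t * t) * (b 0 * (b 1 - b 0)) := by
      simp only [Pi.smul_apply, smul_eq_mul]; ring
    simp only [this, sign_mul]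
    rw [← sign_mul, sign_pos (mul_self_pos.2 ht), one_mul])

theorem side_mk (v : Fin 2 → ℝ) (hv : v ≠ 0) :
    side (Projectivization.mk ℝ v hv) = SignType.sign (v 0 * (v 1 - v 0)) := rfl

theorem side_ofInt_smul_mk (m : SL(2, ℤ)) (v : Fin 2 → ℝ) (hv : v ≠ 0) :
    side (ofInt m • Projectivization.mk ℝ v hv) =
      SignType.sign (((m 0 0 : ℝ) * v 0 + m 0 1 * v 1) *
        ((m 1 0 * v 0 + m 1 1 * v 1) - (m 0 0 * v 0 + m 0 1 * v 1))) := by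
  obtain ⟨h, e⟩ := ofInt_smul_mk m v hv
  rw [e, side_mk]
  simp

theorem side_leftMap_smul_mk (v : Fin 2 → ℝ) (hv : v ≠ 0) :
    side (leftMap • Projectivization.mk ℝ v hv) = SignType.sign (v 0 * v 1) := by
  rw [leftMap, side_ofInt_smul_mk]; simp [matLeft]

theorem side_rightMap_smul_mk (v : Fin 2 → ℝ) (hv : v ≠ 0) :
    side (rightMap • Projectivization.mk ℝ v hv) = SignType.sign (v 1 * (v 1 - v 0)) := by
  rw [rightMap, side_ofInt_smul_mk]; simp [matRight]; congr 1; ring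

theorem side_leftMap_smul {y : ProjLine} (h : side y = 1) : side (leftMap • y) = 1 := by
  induction y using Projectivization.ind with
  | h v hv =>
    rw [side_mk, sign_eq_one_iff] at h
    rw [side_leftMap_smul_mk, sign_eq_one_iff]
    nlinarith [sq_nonneg (v 0)]

theorem side_rightMap_smul {y : ProjLine} (h : side y = 1) : side (rightMap • y) = 1 := by
  induction y using Projectivization.ind with
  | h v hv =>
    rw [side_mk, sign_eq_one_iff] at h
    rw [side_rightMap_smul_mk, sign_eq_one_iff]
    nlinarith [sq_nonneg (v 1 - v 0)]

/-- The indicator of the complement of the closed arc `[0, 1]`. -/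
noncomputable def outside (y : ProjLine) : ℝ := if side y = -1 then 1 else 0

/-- A half map throws a point out of `[0, 1]` only if that point lies in one particular arc outside
`[0, 1]`, and these two arcs are disjoint. -/
theorem outside_left_add_outside_right_le (y : ProjLine) :
    outside (leftMap • y) + outside (rightMap • y) ≤ outside y := by
  induction y using Projectivization.ind with
  | h v hv =>
    unfold outside
    rw [side_mk, side_leftMap_smul_mk, side_rightMap_smul_mk]
    simp only [sign_eq_neg_one_iff]
    split_ifs with h1 h2 h3 h3 h2 h3 h3 <;> norm_num
    · nlinarith [sq_nonneg (v 1)]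
    · nlinarith [sq_nonneg (v 1)]
    · nlinarith [sq_nonneg (v 0)]
    · nlinarith [sq_nonneg (v 1 - v 0)]

theorem outside_nonneg (y : ProjLine) : 0 ≤ outside y := by
  unfold outside; split_ifs <;> norm_num

theorem outside_le_one (y : ProjLine) : outside y ≤ 1 := by
  unfold outside; split_ifs <;> norm_num

/-! ### Reduced words -/

/-- The open arc behind the generator `gen i`. -/
def arc (i : Fin 3) : Set ProjLine := {y | side ((rot i)⁻¹ • y) = 1}

theorem arc_nonempty (i : Fin 3) : (arc i).Nonempty := by
  refine ⟨rot i • Projectivization.mk ℝ ![1, 2] (fun h => one_ne_zero (congrFun h 0)), ?_⟩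
  change side _ = 1
  rw [inv_smul_smul, side_mk, sign_eq_one_iff]
  norm_num

theorem eq_add_one_or_eq_add_two {i j : Fin 3} (h : j ≠ i) : j = i + 1 ∨ j = i + 2 := by
  revert i j; decide

theorem rot_mul (i j : Fin 3) : rot i * rot j = rot (i + j) := by
  rw [rot, rot, rot, ← map_mul]
  have : matRot i * matRot j = matRot (i + j) ∨ matRot i * matRot j = - matRot (i + j) := by
    revert i j; decide
  rcases this with h | h
  · rw [h]
  · rw [h, ofInt_neg]

theorem rot_zero : rot 0 = 1 := map_one _

theorem rot_inv (i : Fin 3) : (rot i)⁻¹ = rot (-i) := by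
  rw [inv_eq_iff_mul_eq_one, rot_mul, add_neg_cancel, rot_zero]

/-- If `u (v - u)` is positive, then the two values of the form at the rotated points are
nonpositive. -/
theorem side_rot_smul_ne {y : ProjLine} (h : side y = 1) {i : Fin 3} (hi : i ≠ 0) :
    side (rot i • y) ≠ 1 := by
  induction y using Projectivization.ind with
  | h v hv =>
    rw [side_mk, sign_eq_one_iff] at h
    rw [rot, side_ofInt_smul_mk, Ne, sign_eq_one_iff, not_lt]
    fin_cases i
    · exact absurd rfl hi
    · simp [matRot, matRho]
      nlinarith [sq_nonneg (v 1), sq_nonneg (v 0)]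
    · simp [matRot]
      nlinarith [sq_nonneg (v 1 - v 0)]

theorem arc_disjoint {i j : Fin 3} (h : i ≠ j) : Disjoint (arc i) (arc j) := by
  rw [Set.disjoint_left]
  intro y hi hj
  refine side_rot_smul_ne hi (i := i - j) (sub_ne_zero.2 h) ?_
  rw [rot_inv, smul_smul, rot_mul, show i - j + -i = -j by abel, ← rot_inv]
  exact hj

/-- The ping-pong step: a generator maps each of the two other arcs into its own. -/
theorem gen_smul_mem_arc {i j : Fin 3} (h : j ≠ i) {y : ProjLine} (hy : y ∈ arc j) :
    gen i • y ∈ arc i := by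
  change side _ = 1
  rw [smul_smul]
  rcases eq_add_one_or_eq_add_two h with rfl | rfl
  · rw [inv_rot_mul_gen_left, mul_smul]; exact side_leftMap_smul hy
  · rw [inv_rot_mul_gen_right, mul_smul]; exact side_rightMap_smul hy

open Classical in
/-- The reduced words of length `n + 1` with first letter `gen i`, as elements of the group. -/
noncomputable def words : ℕ → Fin 3 → Finset PSL2R
  | 0, i => {gen i}
  | n + 1, i => (words n (i + 1)).image (gen i * ·) ∪ (words n (i + 2)).image (gen i * ·)

theorem mem_words_succ {n : ℕ} {i : Fin 3} {g : PSL2R} :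
    g ∈ words (n + 1) i ↔ ∃ j ≠ i, ∃ d ∈ words n j, gen i * d = g := by
  simp only [words, Finset.mem_union, Finset.mem_image]
  constructor
  · rintro (⟨d, hd, rfl⟩ | ⟨d, hd, rfl⟩)
    · exact ⟨i + 1, by simp, d, hd, rfl⟩
    · exact ⟨i + 2, by simp, d, hd, rfl⟩
  · rintro ⟨j, hj, d, hd, rfl⟩
    rcases eq_add_one_or_eq_add_two hj with rfl | rfl
    · exact Or.inl ⟨d, hd, rfl⟩
    · exact Or.inr ⟨d, hd, rfl⟩

/-- A reduced word maps every arc, except the one behind its last letter, into the arc behind its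
first letter. -/
theorem words_smul_mem_arc {n : ℕ} {i : Fin 3} {g : PSL2R} (hg : g ∈ words n i) :
    ∃ l, ∀ u ≠ l, ∀ y ∈ arc u, g • y ∈ arc i := by
  induction n generalizing i g with
  | zero =>
    rw [words, Finset.mem_singleton] at hg
    subst hg
    exact ⟨i, fun u hu y hy => gen_smul_mem_arc hu hy⟩
  | succ n ih =>
    obtain ⟨j, hj, d, hd, rfl⟩ := mem_words_succ.1 hg
    obtain ⟨l, hl⟩ := ih hd
    refine ⟨l, fun u hu y hy => ?_⟩
    rw [mul_smul]
    exact gen_smul_mem_arc hj (hl u hu y hy)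

theorem exists_ne_and_ne (i j : Fin 3) : ∃ k, k ≠ i ∧ k ≠ j := by
  revert i j; decide

/-- The first letter of a reduced word is determined by the group element: two words differ in their
last letters from some third letter, whose arc both of them map into the arcs of their first
letters. -/
theorem eq_of_mem_words {n m : ℕ} {i j : Fin 3} {g : PSL2R} (h : g ∈ words n i)
    (h' : g ∈ words m j) : i = j := by
  obtain ⟨l, hl⟩ := words_smul_mem_arc h
  obtain ⟨l', hl'⟩ := words_smul_mem_arc h'
  obtain ⟨k, hk, hk'⟩ := exists_ne_and_ne l l'
  obtain ⟨y, hy⟩ := arc_nonempty k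
  by_contra hij
  exact Set.disjoint_left.1 (arc_disjoint hij) (hl k hk y hy) (hl' k hk' y hy)

theorem one_notMem_words (n : ℕ) (i : Fin 3) : (1 : PSL2R) ∉ words n i := by
  intro h
  obtain ⟨l, hl⟩ := words_smul_mem_arc h
  obtain ⟨k, hk, hk'⟩ := exists_ne_and_ne l i
  obtain ⟨y, hy⟩ := arc_nonempty k
  have := hl k hk y hy
  rw [one_smul] at this
  exact Set.disjoint_left.1 (arc_disjoint hk') hy this

theorem length_eq_of_mem_words {n m : ℕ} {i j : Fin 3} {g : PSL2R} (h : g ∈ words n i)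
    (h' : g ∈ words m j) : n = m := by
  induction n generalizing m i j g with
  | zero =>
    obtain rfl := eq_of_mem_words h h'
    cases m with
    | zero => rfl
    | succ m =>
      obtain ⟨k, hk, d, hd, e⟩ := mem_words_succ.1 h'
      rw [words, Finset.mem_singleton] at h
      rw [h, mul_eq_left] at e
      exact absurd (e ▸ hd) (one_notMem_words m k)
  | succ n ih =>
    obtain rfl := eq_of_mem_words h h'
    obtain ⟨k, hk, d, hd, e⟩ := mem_words_succ.1 h
    cases m with
    | zero =>
      rw [words, Finset.mem_singleton] at h'
      rw [h', mul_eq_left] at e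
      exact absurd (e ▸ hd) (one_notMem_words n k)
    | succ m =>
      obtain ⟨k', hk', d', hd', e'⟩ := mem_words_succ.1 h'
      obtain rfl : d = d' := mul_left_cancel (e.trans e'.symm)
      rw [ih hd hd']

theorem sum_words_succ (n : ℕ) (i : Fin 3) (F : PSL2R → ℝ) :
    ∑ g ∈ words (n + 1) i, F g =
      ∑ g ∈ words n (i + 1), F (gen i * g) + ∑ g ∈ words n (i + 2), F (gen i * g) := by
  classical
  have hinj : ∀ s : Set PSL2R, Set.InjOn (gen i * ·) s := fun s => (mul_right_injective _).injOn
  rw [words, Finset.sum_union, Finset.sum_image (hinj _), Finset.sum_image (hinj _)]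
  rw [Finset.disjoint_left]
  simp only [Finset.mem_image, not_exists, not_and]
  rintro _ ⟨d, hd, rfl⟩ d' hd' e
  obtain rfl := mul_left_cancel e
  exact absurd (eq_of_mem_words hd hd') (by simp)

theorem card_words (n : ℕ) (i : Fin 3) : ((words n i).card : ℝ) = 2 ^ n := by
  induction n generalizing i with
  | zero => simp [words]
  | succ n ih =>
    have := sum_words_succ n i (fun _ => 1)
    simp only [Finset.sum_const, nsmul_eq_mul, mul_one, ih] at this
    rw [this]; ring

/-! ### Spheres -/

/-- Free reduction: a word in the generators can be shortened to a reduced word with the same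
product. -/
theorem prod_eq_one_or_mem_words (l : List PSL2R) (hl : ∀ s ∈ l, s ∈ gens) :
    l.prod = 1 ∨ ∃ n i, n + 1 ≤ l.length ∧ l.prod ∈ words n i := by
  induction l with
  | nil => exact Or.inl rfl
  | cons s l ih =>
    obtain ⟨i, rfl⟩ := exists_gen_of_mem_gens (hl s (by simp))
    rw [List.prod_cons, List.length_cons]
    rcases ih (fun t ht => hl t (by simp [ht])) with h | ⟨n, j, hn, h⟩
    · exact Or.inr ⟨0, i, by omega, by simp [words, h]⟩
    · by_cases hj : j = i
      · subst hj
        cases n with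
        | zero =>
          rw [words, Finset.mem_singleton] at h
          exact Or.inl (by rw [h, gen_mul_gen])
        | succ n =>
          obtain ⟨k, hk, d, hd, e⟩ := mem_words_succ.1 h
          refine Or.inr ⟨n, k, by omega, ?_⟩
          rwa [← e, ← mul_assoc, gen_mul_gen, one_mul]
      · exact Or.inr ⟨n + 1, i, by omega, mem_words_succ.2 ⟨j, hj, _, h, rfl⟩⟩

theorem exists_list_of_mem_words {n : ℕ} {i : Fin 3} {g : PSL2R} (hg : g ∈ words n i) :
    ∃ l : List PSL2R, l.length = n + 1 ∧ (∀ s ∈ l, s ∈ gens) ∧ l.prod = g := by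
  induction n generalizing i g with
  | zero =>
    rw [words, Finset.mem_singleton] at hg
    exact ⟨[gen i], rfl, by simpa using gen_mem_gens i, by simp [hg]⟩
  | succ n ih =>
    obtain ⟨k, hk, d, hd, rfl⟩ := mem_words_succ.1 hg
    obtain ⟨l, h1, h2, rfl⟩ := ih hd
    refine ⟨gen i :: l, by simp [h1], ?_, by simp⟩
    simpa using ⟨gen_mem_gens i, h2⟩

theorem wordNorm_of_mem_words {n : ℕ} {i : Fin 3} {g : PSL2R} (hg : g ∈ words n i) :
    wordNorm gens g = n + 1 := by
  obtain ⟨l, h⟩ := exists_list_of_mem_words hg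
  refine le_antisymm (Nat.sInf_le ⟨l, h⟩) (le_csInf ⟨_, l, h⟩ ?_)
  rintro m ⟨k, rfl, hk, rfl⟩
  rcases prod_eq_one_or_mem_words k hk with h | ⟨n', j, hn', h⟩
  · exact absurd (h ▸ hg) (one_notMem_words n i)
  · rwa [length_eq_of_mem_words hg h]

theorem wordNorm_one : wordNorm gens (1 : PSL2R) = 0 :=
  Nat.le_zero.1 (Nat.sInf_le ⟨[], rfl, by simp, rfl⟩)

theorem mem_sphere_succ {n : ℕ} {g : PSL2R} : g ∈ sphere (n + 1) ↔ ∃ i, g ∈ words n i := by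
  rw [sphere, Set.Finite.mem_toFinset]
  constructor
  · rintro ⟨hg, hn⟩
    obtain ⟨l, hl, rfl⟩ := exists_word hg
    rcases prod_eq_one_or_mem_words l hl with h | ⟨m, i, -, h⟩
    · rw [h, wordNorm_one] at hn; omega
    · rw [wordNorm_of_mem_words h] at hn
      obtain rfl : m = n := by omega
      exact ⟨i, h⟩
  · rintro ⟨i, hg⟩
    refine ⟨?_, wordNorm_of_mem_words hg⟩
    obtain ⟨l, -, hl, rfl⟩ := exists_list_of_mem_words hg
    exact Subgroup.list_prod_mem _ fun s hs => Subgroup.subset_closure (hl s hs)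

theorem sum_sphere_succ (n : ℕ) (F : PSL2R → ℝ) :
    ∑ g ∈ sphere (n + 1), F g = ∑ i, ∑ g ∈ words n i, F g := by
  classical
  rw [← Finset.sum_biUnion]
  · congr 1
    ext g
    simp [mem_sphere_succ]
  · intro i _ j _ hij
    exact Finset.disjoint_left.2 fun g hi hj => hij (eq_of_mem_words hi hj)

theorem card_sphere_succ (n : ℕ) : ((sphere (n + 1)).card : ℝ) = 3 * 2 ^ n := by
  have := sum_sphere_succ n (fun _ => 1)
  simp only [Finset.sum_const, nsmul_eq_mul, mul_one, card_words] at this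
  simpa using this

/-- The sum of `h` over the points `γ x`, where `γ` runs over the reduced words of length `n + 1`
with first letter `gen i`, read in the coordinate that turns the arc behind that letter into
`[0, 1]`. -/
noncomputable def arcSum (x : ProjLine) (n : ℕ) (i : Fin 3) (h : ProjLine → ℝ) : ℝ :=
  ∑ g ∈ words n i, h ((rot i)⁻¹ • g • x)

theorem arcSum_succ (x : ProjLine) (n : ℕ) (i : Fin 3) (h : ProjLine → ℝ) :
    arcSum x (n + 1) i h = arcSum x n (i + 1) (fun y => h (leftMap • y)) +
      arcSum x n (i + 2) (fun y => h (rightMap • y)) := by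
  unfold arcSum
  rw [sum_words_succ]
  congr 1 <;> refine Finset.sum_congr rfl fun g _ => ?_
  · rw [mul_smul, ← mul_smul _ (gen i), inv_rot_mul_gen_left, mul_smul]
  · rw [mul_smul, ← mul_smul _ (gen i), inv_rot_mul_gen_right, mul_smul]

theorem orbitSum_succ (n : ℕ) (f : ProjLine → ℝ) (x : ProjLine) :
    orbitSum (n + 1) f x = ∑ i, arcSum x n i (fun y => f (rot i • y)) := by
  unfold orbitSum arcSum
  simp only [smul_inv_smul]
  exact sum_sphere_succ n _

/-- Among the points `γ x` with `γ` in a sphere, at most three fail to lie in the closed arc behind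
the first letter of `γ`. -/
theorem sum_arcSum_outside_le (x : ProjLine) (n : ℕ) : ∑ i, arcSum x n i outside ≤ 3 := by
  induction n with
  | zero =>
    refine (Finset.sum_le_sum (g := fun _ => (1 : ℝ)) fun i _ => ?_).trans (by simp)
    simpa [arcSum, words] using outside_le_one _
  | succ n ih =>
    refine le_trans ?_ ih
    simp only [arcSum_succ, Finset.sum_add_distrib]
    have h1 := Equiv.sum_comp (Equiv.addRight (1 : Fin 3))
      (fun i => arcSum x n i (fun y => outside (leftMap • y)))
    have h2 := Equiv.sum_comp (Equiv.addRight (2 : Fin 3))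
      (fun i => arcSum x n i (fun y => outside (rightMap • y)))
    simp only [Equiv.coe_addRight] at h1 h2
    rw [h1, h2, ← Finset.sum_add_distrib]
    refine Finset.sum_le_sum fun i _ => ?_
    unfold arcSum
    rw [← Finset.sum_add_distrib]
    exact Finset.sum_le_sum fun g _ => outside_left_add_outside_right_le _

theorem arcSum_outside_le (x : ProjLine) (n : ℕ) (i : Fin 3) : arcSum x n i outside ≤ 3 :=
  (Finset.single_le_sum (f := fun i => arcSum x n i outside)
    (fun _ _ => Finset.sum_nonneg fun _ _ => outside_nonneg _) (Finset.mem_univ i)).trans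
    (sum_arcSum_outside_le x n)

/-! ### Topology of the projective line -/

theorem continuous_mk :
    Continuous (fun v : {v : Fin 2 → ℝ // v ≠ 0} => Projectivization.mk ℝ v.1 v.2) :=
  continuous_coinduced_rng

theorem continuous_smul_projLine (g : PSL2R) : Continuous (fun y : ProjLine => g • y) := by
  obtain ⟨m, rfl⟩ := QuotientGroup.mk_surjective g
  refine continuous_coinduced_dom.2 ?_
  have h : Continuous (fun v : {v : Fin 2 → ℝ // v ≠ 0} =>
      (⟨m • v.1, (smul_ne_zero_iff_ne m).mpr v.2⟩ : {v : Fin 2 → ℝ // v ≠ 0})) := by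
    refine Continuous.subtype_mk ?_ _
    change Continuous fun v : {v : Fin 2 → ℝ // v ≠ 0} => Matrix.mulVec m.1 v.1
    exact Continuous.matrix_mulVec continuous_const continuous_subtype_val
  exact continuous_mk.comp h

theorem continuous_ofReal : Continuous ofReal := by
  have h : Continuous (fun t : ℝ => (⟨![t, 1], fun h => one_ne_zero (congrFun h 1)⟩ :
      {v : Fin 2 → ℝ // v ≠ 0})) := by
    refine Continuous.subtype_mk ?_ _
    fun_prop
  exact continuous_mk.comp h

theorem mk_eq_ofReal {v : Fin 2 → ℝ} {hv : v ≠ 0} (h : v 1 ≠ 0) :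
    Projectivization.mk ℝ v hv = ofReal (v 0 / v 1) := by
  rw [ofReal, Projectivization.mk_eq_mk_iff']
  refine ⟨v 1, ?_⟩
  ext i
  fin_cases i
  · simp [mul_div_cancel₀ _ h]
  · simp

theorem mk_eq_ofReal_iff {v : Fin 2 → ℝ} {hv : v ≠ 0} {t : ℝ} :
    Projectivization.mk ℝ v hv = ofReal t ↔ v 1 ≠ 0 ∧ v 0 / v 1 = t := by
  constructor
  · intro h
    rw [ofReal, Projectivization.mk_eq_mk_iff'] at h
    obtain ⟨a, rfl⟩ := h
    have ha : a ≠ 0 := by rintro rfl; simp at hv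
    simp [ha]
  · rintro ⟨h, rfl⟩
    exact mk_eq_ofReal h

theorem ofReal_injective : Function.Injective ofReal := by
  intro s t h
  have := (mk_eq_ofReal_iff (v := ![s, 1])).1 h
  simpa using this.2

theorem isOpenEmbedding_ofReal : IsOpenEmbedding ofReal := by
  refine .of_continuous_injective_isOpenMap continuous_ofReal ofReal_injective fun U hU => ?_
  refine isOpen_coinduced.2 ?_
  have e : (fun v : {v : Fin 2 → ℝ // v ≠ 0} => Projectivization.mk ℝ v.1 v.2) ⁻¹' (ofReal '' U) =
      {v | v.1 1 ≠ 0} ∩ (fun v => v.1 0 / v.1 1) ⁻¹' U := by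
    ext ⟨v, hv⟩
    simp only [Set.mem_preimage, Set.mem_image, Set.mem_inter_iff, Set.mem_ofPred_eq]
    constructor
    · rintro ⟨t, ht, h⟩
      obtain ⟨h1, h2⟩ := mk_eq_ofReal_iff.1 h.symm
      exact ⟨h1, h2 ▸ ht⟩
    · rintro ⟨h1, h2⟩
      exact ⟨_, h2, (mk_eq_ofReal h1).symm⟩
  rw [e]
  have h1 : Continuous fun v : {v : Fin 2 → ℝ // v ≠ 0} => v.1 1 :=
    (continuous_apply 1).comp continuous_subtype_val
  have h0 : Continuous fun v : {v : Fin 2 → ℝ // v ≠ 0} => v.1 0 :=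
    (continuous_apply 0).comp continuous_subtype_val
  exact ContinuousOn.isOpen_inter_preimage (h0.continuousOn.div h1.continuousOn fun v hv => hv)
    (isOpen_ne.preimage h1) hU

theorem measurableEmbedding_ofReal : MeasurableEmbedding ofReal :=
  isOpenEmbedding_ofReal.measurableEmbedding

/-! ### The half maps and rotations in the affine coordinate -/

theorem ofInt_smul_ofReal (m : SL(2, ℤ)) {t : ℝ} (h : (m 1 0 : ℝ) * t + m 1 1 ≠ 0) :
    ofInt m • ofReal t = ofReal ((m 0 0 * t + m 0 1) / (m 1 0 * t + m 1 1)) := by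
  rw [ofReal]
  obtain ⟨h', e⟩ := ofInt_smul_mk m ![t, 1] (fun h => one_ne_zero (congrFun h 1))
  rw [e, mk_eq_ofReal (by simpa using h)]
  simp

theorem leftMap_smul_ofReal {t : ℝ} (h : 0 ≤ t) : leftMap • ofReal t = ofReal (t / (1 + t)) := by
  have : (1 : ℝ) + t ≠ 0 := by positivity
  rw [leftMap, ofInt_smul_ofReal] <;> simp [matLeft, add_comm t 1, this]

theorem rightMap_smul_ofReal {t : ℝ} (h : t ≤ 1) : rightMap • ofReal t = ofReal (1 / (2 - t)) := by
  have h2 : -t + 2 = 2 - t := by ring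
  have : (2 : ℝ) - t ≠ 0 := by linarith
  rw [rightMap, ofInt_smul_ofReal] <;> simp [matRight, h2, this]

theorem rot_one_smul_ofReal {t : ℝ} (h : t ≠ 1) : rot 1 • ofReal t = ofReal (1 / (1 - t)) := by
  have h2 : -t + 1 = 1 - t := by ring
  have : (1 : ℝ) - t ≠ 0 := sub_ne_zero.2 h.symm
  rw [rot, ofInt_smul_ofReal] <;> simp [matRot, matRho, h2, this]

theorem rot_two_smul_ofReal {t : ℝ} (h : t ≠ 0) : rot 2 • ofReal t = ofReal (1 - 1 / t) := by
  rw [rot, ofInt_smul_ofReal] <;> simp [matRot, h]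
  congr 1
  field_simp
  ring

theorem exists_ofReal_of_outside_ne_one {y : ProjLine} (h : outside y ≠ 1) :
    ∃ t ∈ Set.Icc (0 : ℝ) 1, y = ofReal t := by
  induction y using Projectivization.ind with
  | h v hv =>
    have h : 0 ≤ v 0 * (v 1 - v 0) := by
      by_contra! h'
      exact h (if_pos (by rw [side_mk, sign_eq_neg_one_iff]; exact h'))
    have h1 : v 1 ≠ 0 := by
      intro h1
      rw [h1] at h
      have h0 : v 0 = 0 := by nlinarith [sq_nonneg (v 0)]
      exact hv (by ext i; fin_cases i <;> simp [h0, h1])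
    refine ⟨_, ?_, mk_eq_ofReal h1⟩
    have hp : 0 < v 1 * v 1 := mul_self_pos.2 h1
    have e : v 0 / v 1 = (v 0 * v 1) / (v 1 * v 1) := by field_simp
    rw [e]
    constructor
    · exact div_nonneg (by nlinarith [sq_nonneg (v 0)]) hp.le
    · rw [div_le_one hp]
      nlinarith [sq_nonneg (v 1 - v 0)]

theorem exists_eq_rot_smul_ofReal (y : ProjLine) :
    ∃ i, ∃ t ∈ Set.Icc (0 : ℝ) 1, y = rot i • ofReal t := by
  suffices ∃ i, outside (rot i • y) ≠ 1 by
    obtain ⟨i, hi⟩ := this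
    obtain ⟨t, ht, e⟩ := exists_ofReal_of_outside_ne_one hi
    exact ⟨-i, t, ht, by rw [← e, ← rot_inv, inv_smul_smul]⟩
  by_contra! H
  have H' : ∀ i, side (rot i • y) = -1 := fun i => by
    by_contra h
    simpa [outside, h] using H i
  induction y using Projectivization.ind with
  | h v hv =>
    have h1 := H' 1
    have h2 := H' 2
    have h0 := H' 0
    rw [rot, side_ofInt_smul_mk, sign_eq_neg_one_iff] at h0 h1 h2
    simp [matRot, matRho] at h0 h1 h2
    nlinarith [sq_nonneg (v 1 - v 0), sq_nonneg (v 0), sq_nonneg (v 1)]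

/-- The projective line is compact, being covered by three arcs. -/
theorem exists_abs_le_of_continuous {f : ProjLine → ℝ} (hf : Continuous f) :
    ∃ K, 0 ≤ K ∧ ∀ y, |f y| ≤ K := by
  have h : ∀ i, ∃ K, ∀ t ∈ Set.Icc (0 : ℝ) 1, ‖f (rot i • ofReal t)‖ ≤ K := fun i =>
    isCompact_Icc.exists_bound_of_continuousOn
      (hf.comp ((continuous_smul_projLine _).comp continuous_ofReal)).continuousOn
  choose K hK using h
  have hb : ∀ y, |f y| ≤ ∑ i, |K i| := fun y => by
    obtain ⟨i, t, ht, rfl⟩ := exists_eq_rot_smul_ofReal y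
    exact ((hK i t ht).trans (le_abs_self _)).trans
      (Finset.single_le_sum (f := fun i => |K i|) (fun _ _ => abs_nonneg _) (Finset.mem_univ i))
  exact ⟨_, Finset.sum_nonneg fun _ _ => abs_nonneg _, hb⟩

/-! ### The recursive structure of the Farey sequences -/

theorem insertMediants_append (l : List ℚ) (q : ℚ) (l' : List ℚ) :
    insertMediants (l ++ q :: l') =
      insertMediants (l ++ [q]) ++ (insertMediants (q :: l')).tail := by
  induction l with
  | nil => cases l' <;> simp [insertMediants]
  | cons p l ih =>
    cases l with
    | nil =>
      cases l' <;> simp [insertMediants]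
    | cons p' l =>
      simp only [List.cons_append, insertMediants] at ih ⊢
      rw [ih]

theorem insertMediants_map {φ : ℚ → ℚ} {S : Set ℚ}
    (hφ : ∀ p ∈ S, ∀ q ∈ S, mediant (φ p) (φ q) = φ (mediant p q)) (l : List ℚ)
    (hl : ∀ q ∈ l, q ∈ S) : insertMediants (l.map φ) = (insertMediants l).map φ := by
  induction l with
  | nil => rfl
  | cons p l ih =>
    cases l with
    | nil => rfl
    | cons q l =>
      simp only [List.map_cons, insertMediants] at ih ⊢
      rw [hφ p (hl p (by simp)) q (hl q (by simp)), ih fun r hr => hl r (by simp [hr])]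

theorem mediant_mem_Icc {p q : ℚ} (hp : p ∈ Set.Icc (0 : ℚ) 1) (hq : q ∈ Set.Icc (0 : ℚ) 1) :
    mediant p q ∈ Set.Icc (0 : ℚ) 1 := by
  have h1 := Rat.num_nonneg.2 hp.1
  have h2 := Rat.num_nonneg.2 hq.1
  have h3 := Rat.num_le_denom_iff.2 hp.2
  have h4 := Rat.num_le_denom_iff.2 hq.2
  unfold mediant
  have h5 : (0 : ℚ) < ((p.den + q.den : ℕ) : ℚ) := by exact_mod_cast Nat.add_pos_left p.pos _
  constructor
  · exact div_nonneg (by exact_mod_cast add_nonneg h1 h2) h5.le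
  · rw [div_le_one h5]
    have : p.num + q.num ≤ ((p.den + q.den : ℕ) : ℤ) := by push_cast; linarith
    exact_mod_cast this

theorem insertMediants_mem_Icc (l : List ℚ) (hl : ∀ q ∈ l, q ∈ Set.Icc (0 : ℚ) 1) :
    ∀ q ∈ insertMediants l, q ∈ Set.Icc (0 : ℚ) 1 := by
  induction l with
  | nil => exact hl
  | cons p l ih =>
    cases l with
    | nil => exact hl
    | cons q l =>
      intro r hr
      simp only [insertMediants, List.mem_cons] at hr
      rcases hr with rfl | rfl | hr
      · exact hl _ (by simp)
      · exact mediant_mem_Icc (hl p (by simp)) (hl q (by simp))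
      · exact ih (fun s hs => hl s (by simp [hs])) r hr

theorem fareySeq_mem_Icc (n : ℕ) : ∀ q ∈ fareySeq n, q ∈ Set.Icc (0 : ℚ) 1 := by
  induction n with
  | zero => simp [fareySeq]
  | succ n ih => exact insertMediants_mem_Icc _ ih

theorem isCoprime_num_den (p : ℚ) : IsCoprime p.num p.den :=
  Int.isCoprime_iff_nat_coprime.2 p.reduced

theorem left_num_den {p : ℚ} (hp : 0 ≤ p) :
    (p / (1 + p)).num = p.num ∧ ((p / (1 + p)).den : ℤ) = p.den + p.num := by
  have h1 := Rat.num_nonneg.2 hp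
  have hd : (0 : ℤ) < p.den := by exact_mod_cast p.pos
  have hpos : 0 < (p.den : ℤ) + p.num := by linarith
  have e : p / (1 + p) = (p.num : ℚ) / ((p.den + p.num : ℤ) : ℚ) := by
    have h3 : ((p.den + p.num : ℤ) : ℚ) ≠ 0 := by exact_mod_cast hpos.ne'
    have h4 : 1 + p ≠ 0 := by positivity
    rw [div_eq_div_iff h4 h3]
    push_cast
    linear_combination Rat.mul_den_eq_num p
  have hc : Nat.Coprime p.num.natAbs ((p.den : ℤ) + p.num).natAbs := by
    obtain ⟨a, b, hab⟩ := isCoprime_num_den p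
    exact Int.isCoprime_iff_nat_coprime.1 ⟨a - b, b, by linear_combination hab⟩
  rw [e]
  exact ⟨Rat.num_div_eq_of_coprime hpos hc, Rat.den_div_eq_of_coprime hpos hc⟩

theorem right_num_den {p : ℚ} (hp : p ≤ 1) :
    (1 / (2 - p)).num = p.den ∧ ((1 / (2 - p)).den : ℤ) = 2 * p.den - p.num := by
  have h1 := Rat.num_le_denom_iff.2 hp
  have hd : (0 : ℤ) < p.den := by exact_mod_cast p.pos
  have hpos : 0 < 2 * (p.den : ℤ) - p.num := by linarith
  have e : 1 / (2 - p) = ((p.den : ℤ) : ℚ) / ((2 * p.den - p.num : ℤ) : ℚ) := by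
    have h3 : ((2 * p.den - p.num : ℤ) : ℚ) ≠ 0 := by exact_mod_cast hpos.ne'
    have h4 : 2 - p ≠ 0 := by linarith
    rw [div_eq_div_iff h4 h3]
    push_cast
    linear_combination Rat.mul_den_eq_num p
  have hc : Nat.Coprime (p.den : ℤ).natAbs (2 * (p.den : ℤ) - p.num).natAbs := by
    obtain ⟨a, b, hab⟩ := isCoprime_num_den p
    exact Int.isCoprime_iff_nat_coprime.1 ⟨b + 2 * a, -a, by linear_combination hab⟩
  rw [e]
  exact ⟨Rat.num_div_eq_of_coprime hpos hc, Rat.den_div_eq_of_coprime hpos hc⟩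

theorem mediant_left {p q : ℚ} (hp : 0 ≤ p) (hq : 0 ≤ q) :
    mediant (p / (1 + p)) (q / (1 + q)) = mediant p q / (1 + mediant p q) := by
  obtain ⟨h1, h2⟩ := left_num_den hp
  obtain ⟨h3, h4⟩ := left_num_den hq
  have h2' : ((p / (1 + p)).den : ℚ) = p.den + p.num := by exact_mod_cast h2
  have h4' : ((q / (1 + q)).den : ℚ) = q.den + q.num := by exact_mod_cast h4
  have h5 : (0 : ℚ) < p.den := by exact_mod_cast p.pos
  have h6 : (0 : ℚ) < q.den := by exact_mod_cast q.pos
  have h7 : (0 : ℚ) ≤ p.num := by exact_mod_cast Rat.num_nonneg.2 hp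
  have h8 : (0 : ℚ) ≤ q.num := by exact_mod_cast Rat.num_nonneg.2 hq
  unfold mediant
  rw [h1, h3]
  push_cast
  rw [h2', h4']
  field_simp
  ring

theorem mediant_right {p q : ℚ} (hp : p ≤ 1) (hq : q ≤ 1) :
    mediant (1 / (2 - p)) (1 / (2 - q)) = 1 / (2 - mediant p q) := by
  obtain ⟨h1, h2⟩ := right_num_den hp
  obtain ⟨h3, h4⟩ := right_num_den hq
  have h2' : ((1 / (2 - p)).den : ℚ) = 2 * p.den - p.num := by exact_mod_cast h2
  have h4' : ((1 / (2 - q)).den : ℚ) = 2 * q.den - q.num := by exact_mod_cast h4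
  have h5 : (0 : ℚ) < p.den := by exact_mod_cast p.pos
  have h6 : (0 : ℚ) < q.den := by exact_mod_cast q.pos
  have h7 : (p.num : ℚ) ≤ p.den := by exact_mod_cast Rat.num_le_denom_iff.2 hp
  have h8 : (q.num : ℚ) ≤ q.den := by exact_mod_cast Rat.num_le_denom_iff.2 hq
  unfold mediant
  rw [h1, h3]
  push_cast
  rw [h2', h4']
  have h9 : (2 * (p.den : ℚ) - p.num + (2 * q.den - q.num)) ≠ 0 := by linarith
  have h10 : (2 : ℚ) - (p.num + q.num) / (p.den + q.den) =
      (2 * (p.den : ℚ) - p.num + (2 * q.den - q.num)) / (p.den + q.den) := by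
    field_simp; ring
  rw [h10, one_div_div]

theorem fareySeq_eq_cons (n : ℕ) : ∃ l, fareySeq n = 0 :: l := by
  induction n with
  | zero => exact ⟨_, rfl⟩
  | succ n ih =>
    obtain ⟨l, hl⟩ := ih
    rw [fareySeq, hl]
    cases l <;> exact ⟨_, rfl⟩

theorem insertMediants_concat (l : List ℚ) (q : ℚ) :
    ∃ l', insertMediants (l ++ [q]) = l' ++ [q] := by
  induction l with
  | nil => exact ⟨[], rfl⟩
  | cons p l ih =>
    obtain ⟨l', h⟩ := ih
    cases l with
    | nil => exact ⟨[p, mediant p q], rfl⟩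
    | cons p' l =>
      refine ⟨p :: mediant p p' :: l', ?_⟩
      simp only [List.cons_append, insertMediants] at h ⊢
      rw [h]

theorem fareySeq_eq_concat (n : ℕ) : ∃ l, fareySeq n = l ++ [1] := by
  induction n with
  | zero => exact ⟨[0], rfl⟩
  | succ n ih =>
    obtain ⟨l, hl⟩ := ih
    rw [fareySeq, hl]
    exact insertMediants_concat l 1

/-- The next Farey sequence consists of the images of the given one under the two half maps, joined
at the common point `1/2`. -/
theorem fareySeq_succ (n : ℕ) : fareySeq (n + 1) = (fareySeq n).map (fun q => q / (1 + q)) ++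
      ((fareySeq n).map (fun q => 1 / (2 - q))).tail := by
  induction n with
  | zero =>
    simp [fareySeq, insertMediants, mediant]
    norm_num
  | succ n e =>
    obtain ⟨l, hl⟩ := fareySeq_eq_concat n
    obtain ⟨l', hl'⟩ := fareySeq_eq_cons n
    have hS := fareySeq_mem_Icc n
    have h1 : insertMediants ((fareySeq n).map (fun q => q / (1 + q))) =
        (fareySeq (n + 1)).map (fun q => q / (1 + q)) :=
      insertMediants_map (fun p hp q hq => mediant_left hp.1 hq.1) _ hS
    have h2 : insertMediants ((fareySeq n).map (fun q => 1 / (2 - q))) =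
        (fareySeq (n + 1)).map (fun q => 1 / (2 - q)) :=
      insertMediants_map (fun p hp q hq => mediant_right hp.2 hq.2) _ hS
    have e1 : (fareySeq n).map (fun q => q / (1 + q)) =
        l.map (fun q => q / (1 + q)) ++ [1 / 2] := by
      rw [hl]; norm_num
    have e2 : (fareySeq n).map (fun q => 1 / (2 - q)) = 1 / 2 :: l'.map (fun q => 1 / (2 - q)) := by
      rw [hl']; norm_num
    rw [← h1, ← h2, fareySeq, e, e1, e2, List.tail_cons, List.append_assoc, List.singleton_append,
      insertMediants_append]

theorem getElem?_fareySeq_succ_left {n k : ℕ} (hk : k ≤ 2 ^ n) :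
    (fareySeq (n + 1))[k]? = (fareySeq n)[k]?.map (fun q => q / (1 + q)) := by
  rw [fareySeq_succ, List.getElem?_append_left, List.getElem?_map]
  rw [List.length_map, length_fareySeq]
  omega

theorem getElem?_fareySeq_zero (n : ℕ) : (fareySeq n)[0]? = some 0 := by
  obtain ⟨l, hl⟩ := fareySeq_eq_cons n
  rw [hl]; rfl

theorem getElem?_fareySeq_two_pow (n : ℕ) : (fareySeq n)[2 ^ n]? = some 1 := by
  obtain ⟨l, hl⟩ := fareySeq_eq_concat n
  have := length_fareySeq n
  rw [hl, List.length_append, List.length_singleton] at this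
  rw [hl, ← Nat.succ_injective this, List.getElem?_concat_length]

theorem getElem?_fareySeq_succ_right (n k : ℕ) :
    (fareySeq (n + 1))[2 ^ n + k]? = (fareySeq n)[k]?.map (fun q => 1 / (2 - q)) := by
  cases k with
  | zero =>
    rw [add_zero, getElem?_fareySeq_succ_left le_rfl, getElem?_fareySeq_two_pow,
      getElem?_fareySeq_zero]
    norm_num
  | succ k =>
    rw [fareySeq_succ, List.getElem?_append_right, List.length_map, length_fareySeq,
      List.getElem?_tail, List.getElem?_map]
    · congr 2; omega
    · rw [List.length_map, length_fareySeq]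
      omega

/-! ### The question-mark function at Farey fractions -/

/-- `FareyValue x y`: the point `x` arises from `0` or `1` by the half maps `t ↦ t / (1 + t)` and
`t ↦ 1 / (2 - t)` of `[0, 1]`, and `y` arises in the same way from `0` or `1` by `t ↦ t / 2` and
`t ↦ (1 + t) / 2`. This is the graph of the question-mark function over the Farey fractions. -/
inductive FareyValue : ℝ → ℝ → Prop
  | zero : FareyValue 0 0
  | one : FareyValue 1 1
  | left {x y : ℝ} : FareyValue x y → FareyValue (x / (1 + x)) (y / 2)
  | right {x y : ℝ} : FareyValue x y → FareyValue (1 / (2 - x)) ((1 + y) / 2)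

theorem FareyValue.mem_Icc {x y : ℝ} (h : FareyValue x y) : x ∈ Set.Icc (0 : ℝ) 1 := by
  induction h with
  | zero => simp
  | one => simp
  | @left x y _ ih =>
    have : 0 < 1 + x := by linarith [ih.1]
    exact ⟨div_nonneg ih.1 this.le, by rw [div_le_one this]; linarith⟩
  | @right x y _ ih =>
    have : 0 < 2 - x := by linarith [ih.2]
    exact ⟨by positivity, by rw [div_le_one this]; linarith [ih.2]⟩

theorem FareyValue.value_mem_Icc {x y : ℝ} (h : FareyValue x y) : y ∈ Set.Icc (0 : ℝ) 1 := by
  induction h with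
  | zero => simp
  | one => simp
  | left _ ih => exact ⟨by linarith [ih.1], by linarith [ih.2]⟩
  | right _ ih => exact ⟨by linarith [ih.1], by linarith [ih.2]⟩

theorem FareyValue.value_eq_zero {x y : ℝ} (h : FareyValue x y) (hx : x = 0) : y = 0 := by
  induction h with
  | zero => rfl
  | one => simp at hx
  | @left x y h ih =>
    have : 1 + x ≠ 0 := by linarith [h.mem_Icc.1]
    rw [ih ((div_eq_zero_iff.1 hx).resolve_right this), zero_div]
  | @right x y h =>
    have : 2 - x ≠ 0 := by linarith [h.mem_Icc.2]
    simp [this] at hx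

theorem FareyValue.value_eq_one {x y : ℝ} (h : FareyValue x y) (hx : x = 1) : y = 1 := by
  induction h with
  | zero => simp at hx
  | one => rfl
  | @left x y h =>
    have : 1 + x ≠ 0 := by linarith [h.mem_Icc.1]
    rw [div_eq_one_iff_eq this] at hx
    linarith
  | @right x y h ih =>
    have : 2 - x ≠ 0 := by linarith [h.mem_Icc.2]
    rw [div_eq_one_iff_eq this] at hx
    rw [ih (by linarith)]; norm_num

theorem FareyValue.mono {x y x' y' : ℝ} (h : FareyValue x y) (h' : FareyValue x' y')
    (hx : x ≤ x') : y ≤ y' := by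
  induction h generalizing x' y' with
  | zero => exact h'.value_mem_Icc.1
  | one => exact (h'.value_eq_one (le_antisymm h'.mem_Icc.2 hx)).ge
  | @left x y h ih =>
    have hp : 0 < 1 + x := by linarith [h.mem_Icc.1]
    cases h' with
    | zero =>
      exact (h.left.value_eq_zero (le_antisymm hx (h.left.mem_Icc.1))).le
    | one => exact h.left.value_mem_Icc.2
    | @left x' y' h' =>
      have hp' : 0 < 1 + x' := by linarith [h'.mem_Icc.1]
      rw [div_le_div_iff₀ hp hp'] at hx
      linarith [ih h' (by linarith)]
    | @right x' y' h' => linarith [h.value_mem_Icc.2, h'.value_mem_Icc.1]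
  | @right x y h ih =>
    have hp : 0 < 2 - x := by linarith [h.mem_Icc.2]
    cases h' with
    | zero =>
      exact (h.right.value_eq_zero (le_antisymm hx (h.right.mem_Icc.1))).le
    | one => exact h.right.value_mem_Icc.2
    | @left x' y' h' =>
      have hp' : 0 < 1 + x' := by linarith [h'.mem_Icc.1]
      rw [div_le_div_iff₀ hp hp'] at hx
      have hm : x * x' ≤ x := mul_le_of_le_one_right h.mem_Icc.1 h'.mem_Icc.2
      have h0 : x = 0 := by
        nlinarith [h.mem_Icc.1, h'.mem_Icc.2]
      have h1 : x' = 1 := by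
        subst h0; linarith [h'.mem_Icc.2]
      linarith [h.value_eq_zero h0, h'.value_eq_one h1]
    | @right x' y' h' =>
      have hp' : 0 < 2 - x' := by linarith [h'.mem_Icc.2]
      rw [div_le_div_iff₀ hp hp'] at hx
      linarith [ih h' (by linarith)]

theorem FareyValue.of_isQuestionMarkValue {q : ℚ} {y : ℝ} (h : IsQuestionMarkValue q y) :
    FareyValue q y := by
  obtain ⟨n, k, hk, rfl⟩ := h
  induction n generalizing q k with
  | zero =>
    rcases k with _ | _ | k
    · simp [fareySeq] at hk; subst hk; simpa using FareyValue.zero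
    · simp [fareySeq] at hk; subst hk; simpa using FareyValue.one
    · simp [fareySeq] at hk
  | succ n ih =>
    by_cases hkn : k ≤ 2 ^ n
    · rw [getElem?_fareySeq_succ_left hkn, Option.map_eq_some_iff] at hk
      obtain ⟨p, hp, rfl⟩ := hk
      have := (ih k hp).left
      rw [pow_succ, ← div_div]
      exact_mod_cast this
    · obtain ⟨k, rfl⟩ := Nat.exists_eq_add_of_le (not_le.1 hkn).le
      rw [getElem?_fareySeq_succ_right, Option.map_eq_some_iff] at hk
      obtain ⟨p, hp, rfl⟩ := hk
      have := (ih k hp).right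
      have e : ((2 ^ n + k : ℕ) : ℝ) / 2 ^ (n + 1) = (1 + k / 2 ^ n) / 2 := by
        push_cast; field_simp; ring
      rw [e]
      exact_mod_cast this

theorem FareyValue.exists_isQuestionMarkValue {x y : ℝ} (h : FareyValue x y) :
    ∃ q : ℚ, (q : ℝ) = x ∧ IsQuestionMarkValue q y := by
  induction h with
  | zero => exact ⟨0, by simp, 0, 0, rfl, by simp⟩
  | one => exact ⟨1, by simp, 0, 1, rfl, by simp⟩
  | left _ ih =>
    obtain ⟨q, rfl, n, k, hk, rfl⟩ := ih
    refine ⟨q / (1 + q), by push_cast; rfl, n + 1, k, ?_, by rw [pow_succ, div_div]⟩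
    have hlt := (List.getElem?_eq_some_iff.1 hk).1
    rw [length_fareySeq] at hlt
    rw [getElem?_fareySeq_succ_left (by omega), hk]; rfl
  | right _ ih =>
    obtain ⟨q, rfl, n, k, hk, rfl⟩ := ih
    refine ⟨1 / (2 - q), by push_cast; rfl, n + 1, 2 ^ n + k, ?_, by push_cast; field_simp; ring⟩
    rw [getElem?_fareySeq_succ_right, hk]; rfl

theorem FareyValue.questionMark_eq {x y : ℝ} (h : FareyValue x y) : questionMark x = y := by
  obtain ⟨q, hq, hy⟩ := h.exists_isQuestionMarkValue
  refine le_antisymm (Real.sSup_le ?_ h.value_mem_Icc.1)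
    (le_csSup (questionMark_bddAbove x) ⟨q, hq.le, hy⟩)
  rintro z ⟨p, hp, hz⟩
  exact (FareyValue.of_isQuestionMarkValue hz).mono h hp

theorem exists_fareyValue_dyadic (n k : ℕ) (hk : k ≤ 2 ^ n) :
    ∃ x, FareyValue x ((k : ℝ) / 2 ^ n) := by
  induction n generalizing k with
  | zero =>
    rw [pow_zero] at hk
    interval_cases k
    · exact ⟨0, by simpa using FareyValue.zero⟩
    · exact ⟨1, by simpa using FareyValue.one⟩
  | succ n ih =>
    by_cases hkn : k ≤ 2 ^ n
    · obtain ⟨x, hx⟩ := ih k hkn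
      exact ⟨_, by rw [pow_succ, ← div_div]; exact hx.left⟩
    · obtain ⟨k, rfl⟩ := Nat.exists_eq_add_of_le (not_le.1 hkn).le
      obtain ⟨x, hx⟩ := ih k (by rw [pow_succ] at hk; omega)
      have e : ((2 ^ n + k : ℕ) : ℝ) / 2 ^ (n + 1) = (1 + k / 2 ^ n) / 2 := by
        push_cast; field_simp; ring
      exact ⟨_, by rw [e]; exact hx.right⟩

/-! ### The extended question-mark function -/

/-- The integral part `∑_{k < n} 2^{-|k|}` of the extended question-mark function. -/
noncomputable def weightSum (n : ℤ) : ℝ := ∑' k : {k : ℤ // k < n}, 1 / (2 : ℝ) ^ (k : ℤ).natAbs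

theorem extQuestionMark_eq (x : ℝ) : extQuestionMark x =
    (1 / 3) * (weightSum ⌊x⌋ + questionMark (Int.fract x) / 2 ^ ⌊x⌋.natAbs) := rfl

theorem weightSum_zero : weightSum 0 = 1 := by
  let e : ℕ ≃ {k : ℤ // k < 0} :=
    { toFun := fun n => ⟨-(n + 1 : ℤ), by omega⟩
      invFun := fun k => (-k.1 - 1).toNat
      left_inv := fun n => by simp
      right_inv := fun k => by
        have := k.2
        ext
        simp only
        omega }
  rw [weightSum, ← e.tsum_eq]
  have h : ∀ n : ℕ, 1 / (2 : ℝ) ^ (e n : ℤ).natAbs = 1 / 2 / 2 ^ n := fun n => by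
    have : (e n : ℤ).natAbs = n + 1 := by
      change (-(n + 1 : ℤ)).natAbs = n + 1
      omega
    rw [this, pow_succ, div_div, mul_comm]
  simp only [h, tsum_geometric_two']

theorem weightSum_succ (n : ℤ) : weightSum (n + 1) = weightSum n + 1 / 2 ^ n.natAbs :=
  (tsum_weight_succ n).symm

theorem weightSum_natCast (n : ℕ) : weightSum n = 3 - 2 / 2 ^ n := by
  induction n with
  | zero => simp [weightSum_zero]; norm_num
  | succ n ih =>
    push_cast
    rw [weightSum_succ, ih, Int.natAbs_natCast]
    field_simp; ring

theorem weightSum_neg_natCast (n : ℕ) : weightSum (-n) = 1 / 2 ^ n := by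
  induction n with
  | zero => simp [weightSum_zero]
  | succ n ih =>
    have := weightSum_succ (-(n + 1 : ℕ))
    rw [Int.natAbs_neg, Int.natAbs_natCast, show (-((n + 1 : ℕ) : ℤ)) + 1 = -n by push_cast; ring,
      ih] at this
    have e : (1 : ℝ) / 2 ^ n = 1 / 2 ^ (n + 1) + 1 / 2 ^ (n + 1) := by
      field_simp; ring
    linarith

theorem extQuestionMark_add_one {t : ℝ} (ht : 0 ≤ t) :
    extQuestionMark (t + 1) = (extQuestionMark t + 1) / 2 := by
  obtain ⟨n, hn⟩ := Int.eq_ofNat_of_zero_le (Int.floor_nonneg.2 ht)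
  have h1 := weightSum_natCast (n + 1)
  rw [extQuestionMark_eq, extQuestionMark_eq, Int.fract_add_one, Int.floor_add_one, hn,
    weightSum_natCast, show (n : ℤ) + 1 = ((n + 1 : ℕ) : ℤ) by push_cast; ring, h1,
    Int.natAbs_natCast, Int.natAbs_natCast]
  field_simp; ring

theorem extQuestionMark_sub_one {t : ℝ} (ht : t < 1) :
    extQuestionMark (t - 1) = extQuestionMark t / 2 := by
  have h0 : ⌊t⌋ ≤ 0 := Int.lt_add_one_iff.1 (Int.floor_lt.2 (by simpa using ht))
  obtain ⟨n, hn⟩ := Int.eq_ofNat_of_zero_le (neg_nonneg.2 h0)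
  obtain hn : ⌊t⌋ = -n := by omega
  have h1 := weightSum_neg_natCast (n + 1)
  rw [extQuestionMark_eq, extQuestionMark_eq, Int.fract_sub_one, Int.floor_sub_one, hn,
    weightSum_neg_natCast, show -(n : ℤ) - 1 = -((n + 1 : ℕ) : ℤ) by push_cast; ring, h1,
    Int.natAbs_neg, Int.natAbs_neg, Int.natAbs_natCast, Int.natAbs_natCast]
  field_simp; ring

theorem extQuestionMark_zero : extQuestionMark 0 = 1 / 3 := by
  simp [extQuestionMark_eq, weightSum_zero, FareyValue.zero.questionMark_eq]

theorem extQuestionMark_natCast (n : ℕ) : extQuestionMark n = 1 - 2 / 3 / 2 ^ n := by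
  rw [extQuestionMark_eq, Int.floor_natCast, weightSum_natCast, Int.fract_natCast,
    FareyValue.zero.questionMark_eq]
  ring

theorem extQuestionMark_neg_natCast (n : ℕ) : extQuestionMark (-n) = 1 / 3 / 2 ^ n := by
  have h : (-(n : ℝ)) = ((-n : ℤ) : ℝ) := by push_cast; rfl
  rw [extQuestionMark_eq, h, Int.floor_intCast, weightSum_neg_natCast, Int.fract_intCast,
    FareyValue.zero.questionMark_eq]
  ring

/-- On `[0, 1]` the extended function is an affine copy of the question-mark function. -/
theorem FareyValue.extQuestionMark_eq {x y : ℝ} (h : FareyValue x y) :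
    extQuestionMark x = (1 + y) / 3 := by
  rcases h.mem_Icc.2.lt_or_eq with hx | hx
  · have hf : ⌊x⌋ = 0 := Int.floor_eq_zero_iff.2 ⟨h.mem_Icc.1, hx⟩
    have hfr : Int.fract x = x := Int.fract_eq_self.2 ⟨h.mem_Icc.1, hx⟩
    rw [Farey.extQuestionMark_eq, hf, hfr, weightSum_zero, h.questionMark_eq]
    simp; ring
  · have := extQuestionMark_natCast 1
    rw [h.value_eq_one hx, hx]
    norm_num at this ⊢
    exact this

/-- The values on the arc `[1, ∞)`, the image of `[0, 1)` under `t ↦ 1 / (1 - t)`. Conjugated by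
this rotation, the right half map becomes the translation by one. -/
theorem FareyValue.extQuestionMark_rot_one {x y : ℝ} (h : FareyValue x y) (hx : x < 1) :
    extQuestionMark (1 / (1 - x)) = (2 + y) / 3 := by
  induction h with
  | zero => rw [sub_zero, div_one, FareyValue.one.extQuestionMark_eq]; norm_num
  | one => simp at hx
  | @left x y h _ =>
    have h0 := h.mem_Icc.1
    have hp : 1 + x ≠ 0 := by positivity
    have e : 1 / (1 - x / (1 + x)) = x + 1 := by field_simp; ring
    rw [e, extQuestionMark_add_one h0, h.extQuestionMark_eq]
    ring
  | @right x y h ih =>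
    have h0 := h.mem_Icc
    have hp : 2 - x ≠ 0 := by linarith [h0.2]
    have hx' : x < 1 := by
      rw [div_lt_one (by linarith [h0.2])] at hx; linarith
    have hp' : 1 - x ≠ 0 := by linarith
    have e : 1 / (1 - 1 / (2 - x)) = 1 / (1 - x) + 1 := by
      rw [one_sub_div hp, one_div_div]
      have : 2 - x - 1 = 1 - x := by ring
      rw [this]; field_simp; ring
    rw [e, extQuestionMark_add_one (by rw [one_div, inv_nonneg]; linarith), ih hx']
    ring

/-- The values on the arc `(-∞, 0]`, the image of `(0, 1]` under `t ↦ 1 - 1 / t`. Conjugated by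
this rotation, the left half map becomes the translation by minus one. -/
theorem FareyValue.extQuestionMark_rot_two {x y : ℝ} (h : FareyValue x y) (hx : 0 < x) :
    extQuestionMark (1 - 1 / x) = y / 3 := by
  induction h with
  | zero => simp at hx
  | one => simpa using extQuestionMark_zero
  | @left x y h ih =>
    have h0 := h.mem_Icc
    have hx' : 0 < x := h0.1.lt_of_ne (by rintro rfl; simp at hx)
    have e : 1 - 1 / (x / (1 + x)) = 1 - 1 / x - 1 := by field_simp; ring
    have h1 : 1 - 1 / x < 1 := by
      have : 0 < 1 / x := by positivity
      linarith
    rw [e, extQuestionMark_sub_one h1, ih hx']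
    ring
  | @right x y h _ =>
    have e : 1 - 1 / (1 / (2 - x)) = x - 1 := by rw [one_div_one_div]; ring
    rw [e]
    rcases h.mem_Icc.2.lt_or_eq with hx | hx
    · rw [extQuestionMark_sub_one hx, h.extQuestionMark_eq]; ring
    · rw [h.value_eq_one hx, hx, sub_self, extQuestionMark_zero]; norm_num

theorem extQuestionMark_pos (x : ℝ) : 0 < extQuestionMark x := by
  obtain ⟨n, hn⟩ := exists_nat_ge (-x)
  refine lt_of_lt_of_le ?_ (extQuestionMark_mono (show -(n : ℝ) ≤ x by linarith))
  rw [extQuestionMark_neg_natCast]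
  positivity

theorem extQuestionMark_lt_one (x : ℝ) : extQuestionMark x < 1 := by
  obtain ⟨n, hn⟩ := exists_nat_ge x
  refine lt_of_le_of_lt (extQuestionMark_mono hn) ?_
  rw [extQuestionMark_natCast]
  have : (0 : ℝ) < 2 / 3 / 2 ^ n := by positivity
  linarith

theorem exists_extQuestionMark_eq (n k : ℕ) (hk : 0 < k) (hk' : k < 3 * 2 ^ n) :
    ∃ x, extQuestionMark x = (k : ℝ) / 2 ^ n / 3 := by
  have h2 : (0 : ℝ) < 2 ^ n := by positivity
  rcases lt_or_ge k (2 ^ n) with h | h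
  · obtain ⟨x, hx⟩ := exists_fareyValue_dyadic n k h.le
    refine ⟨_, hx.extQuestionMark_rot_two (hx.mem_Icc.1.lt_of_ne fun h0 => ?_)⟩
    have h0 := hx.value_eq_zero h0.symm
    have : (0 : ℝ) < k := by exact_mod_cast hk
    exact (div_pos this h2).ne' h0
  obtain ⟨k, rfl⟩ := Nat.exists_eq_add_of_le h
  rcases lt_or_ge k (2 ^ n) with h | h
  · obtain ⟨x, hx⟩ := exists_fareyValue_dyadic n k h.le
    refine ⟨_, hx.extQuestionMark_eq.trans ?_⟩
    push_cast; field_simp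
  obtain ⟨k, rfl⟩ := Nat.exists_eq_add_of_le h
  have h : k < 2 ^ n := by omega
  obtain ⟨x, hx⟩ := exists_fareyValue_dyadic n k h.le
  refine ⟨_, (hx.extQuestionMark_rot_one (hx.mem_Icc.2.lt_of_ne fun h1 => ?_)).trans ?_⟩
  · have h1 := hx.value_eq_one h1
    rw [div_eq_one_iff_eq h2.ne'] at h1
    have : k = 2 ^ n := by exact_mod_cast h1
    omega
  · push_cast; field_simp; ring

/-- The values of the extended question-mark function are dense in `[0, 1]`. -/
theorem exists_extQuestionMark_mem_Ioo {u v : ℝ} (hu : 0 ≤ u) (huv : u < v) (hv : v ≤ 1) :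
    ∃ x, extQuestionMark x ∈ Set.Ioo u v := by
  obtain ⟨n, hn⟩ := exists_pow_lt_of_lt_one (sub_pos.2 huv) (show (1 / 2 : ℝ) < 1 by norm_num)
  have h2 : (0 : ℝ) < 2 ^ n := by positivity
  rw [one_div_pow, div_lt_iff₀ h2] at hn
  set k := ⌊u * (3 * 2 ^ n)⌋₊ with hk
  have h3 : (k : ℝ) ≤ u * (3 * 2 ^ n) := Nat.floor_le (by positivity)
  have h4 : u * (3 * 2 ^ n) < k + 1 := Nat.lt_floor_add_one _
  have h5 : ((k + 1 : ℕ) : ℝ) < v * (3 * 2 ^ n) := by push_cast; nlinarith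
  have h6 : v * (3 * 2 ^ n) ≤ 3 * 2 ^ n := mul_le_of_le_one_left (by positivity) hv
  have h7 : ((k + 1 : ℕ) : ℝ) < ((3 * 2 ^ n : ℕ) : ℝ) := by
    push_cast at h5 ⊢; linarith
  obtain ⟨x, hx⟩ := exists_extQuestionMark_eq n (k + 1) (by omega) (by exact_mod_cast h7)
  refine ⟨x, ?_⟩
  rw [hx, div_div, mul_comm _ (3 : ℝ)]
  constructor
  · rw [lt_div_iff₀ (by positivity)]; push_cast; exact h4
  · rw [div_lt_iff₀ (by positivity)]; exact h5

theorem continuous_extQuestionMark : Continuous extQuestionMark := by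
  refine continuous_iff_continuousAt.2 fun a => continuousAt_iff_continuous_left_right.2 ⟨?_, ?_⟩
  · refine continuousWithinAt_left_of_monotoneOn_of_exists_between
      (extQuestionMark_mono.monotoneOn Set.univ) univ_mem fun b hb => ?_
    obtain ⟨x, hx⟩ := exists_extQuestionMark_mem_Ioo (le_max_right b 0)
      (max_lt hb (extQuestionMark_pos a)) (extQuestionMark_lt_one a).le
    exact ⟨x, trivial, (le_max_left _ _).trans_lt hx.1, hx.2⟩
  · refine continuousWithinAt_right_of_monotoneOn_of_exists_between
      (extQuestionMark_mono.monotoneOn Set.univ) univ_mem fun b hb => ?_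
    obtain ⟨x, hx⟩ := exists_extQuestionMark_mem_Ioo (extQuestionMark_pos a).le
      (lt_min hb (extQuestionMark_lt_one a)) (min_le_right b 1)
    exact ⟨x, trivial, hx.1, hx.2.trans_le (min_le_left _ _)⟩

theorem tendsto_extQuestionMark_atTop : Tendsto extQuestionMark atTop (𝓝 1) := by
  refine tendsto_atTop_isLUB extQuestionMark_mono ⟨?_, fun b hb => ?_⟩
  · rintro _ ⟨x, rfl⟩; exact (extQuestionMark_lt_one x).le
  · by_contra! h
    obtain ⟨x, hx⟩ := exists_extQuestionMark_mem_Ioo (le_max_right b 0)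
      (max_lt h zero_lt_one) le_rfl
    exact absurd (hb ⟨x, rfl⟩) (not_le.2 ((le_max_left _ _).trans_lt hx.1))

theorem tendsto_extQuestionMark_atBot : Tendsto extQuestionMark atBot (𝓝 0) := by
  refine tendsto_atBot_isGLB extQuestionMark_mono ⟨?_, fun b hb => ?_⟩
  · rintro _ ⟨x, rfl⟩; exact (extQuestionMark_pos x).le
  · by_contra! h
    obtain ⟨x, hx⟩ := exists_extQuestionMark_mem_Ioo le_rfl (lt_min h zero_lt_one)
      (min_le_right b 1)
    exact absurd (hb ⟨x, rfl⟩) (not_le.2 (hx.2.trans_le (min_le_left _ _)))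

/-! ### The extended Minkowski measure on the real line -/

/-- The Lebesgue–Stieltjes measure of the extended question-mark function on the real line. -/
noncomputable def lineMeasure : Measure ℝ := extQuestionMark_mono.stieltjesFunction.measure

theorem stieltjesFunction_extQuestionMark :
    ⇑extQuestionMark_mono.stieltjesFunction = extQuestionMark := by
  ext x
  rw [Monotone.stieltjesFunction_eq]
  exact (continuous_extQuestionMark.continuousAt.continuousWithinAt).rightLim_eq

theorem leftLim_extQuestionMark (x : ℝ) :
    Function.leftLim extQuestionMark x = extQuestionMark x :=
  (continuous_extQuestionMark.continuousAt.continuousWithinAt).leftLim_eq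

theorem lineMeasure_Ico (s t : ℝ) :
    lineMeasure (Set.Ico s t) = ENNReal.ofReal (extQuestionMark t - extQuestionMark s) := by
  rw [lineMeasure, StieltjesFunction.measure_Ico, stieltjesFunction_extQuestionMark,
    leftLim_extQuestionMark, leftLim_extQuestionMark]

theorem lineMeasure_Iio (t : ℝ) :
    lineMeasure (Set.Iio t) = ENNReal.ofReal (extQuestionMark t) := by
  rw [lineMeasure, StieltjesFunction.measure_Iio (l := 0), stieltjesFunction_extQuestionMark,
    leftLim_extQuestionMark, sub_zero]
  rw [stieltjesFunction_extQuestionMark]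
  exact tendsto_extQuestionMark_atBot

theorem lineMeasure_Ici (t : ℝ) :
    lineMeasure (Set.Ici t) = ENNReal.ofReal (1 - extQuestionMark t) := by
  rw [lineMeasure, StieltjesFunction.measure_Ici (l := 1), stieltjesFunction_extQuestionMark,
    leftLim_extQuestionMark]
  rw [stieltjesFunction_extQuestionMark]
  exact tendsto_extQuestionMark_atTop

instance isProbabilityMeasure_lineMeasure : IsProbabilityMeasure lineMeasure := by
  refine ⟨?_⟩
  rw [lineMeasure, StieltjesFunction.measure_univ (l := 0) (u := 1)]
  · simp
  · rw [stieltjesFunction_extQuestionMark]; exact tendsto_extQuestionMark_atBot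
  · rw [stieltjesFunction_extQuestionMark]; exact tendsto_extQuestionMark_atTop

theorem minkowskiMeasure_eq_map : minkowskiMeasure = lineMeasure.map ofReal := rfl

theorem isProbabilityMeasure_minkowskiMeasure : IsProbabilityMeasure minkowskiMeasure :=
  (Measure.isProbabilityMeasure_map (μ := lineMeasure)
    measurableEmbedding_ofReal.measurable.aemeasurable :)

theorem minkowskiMeasure_image_Ico (s t : ℝ) : minkowskiMeasure (ofReal '' Set.Ico s t) =
    ENNReal.ofReal (extQuestionMark t - extQuestionMark s) := by
  rw [minkowskiMeasure_eq_map, measurableEmbedding_ofReal.map_apply,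
    Set.preimage_image_eq _ ofReal_injective, lineMeasure_Ico]

/-! ### Farey intervals -/

/-- The half maps of `[0, 1]` in the affine coordinate: the left one for `false`, the right one
for `true`. -/
noncomputable def halfFun (b : Bool) (t : ℝ) : ℝ := if b then 1 / (2 - t) else t / (1 + t)

/-- The half maps as elements of the group. -/
def halfMap (b : Bool) : PSL2R := if b then rightMap else leftMap

/-- The composition of half maps prescribed by a binary word, the first letter being applied last.
It maps `[0, 1]` onto a Farey interval whose level is the length of the word. -/
noncomputable def wordFun : List Bool → ℝ → ℝ
  | [], t => t
  | b :: e, t => halfFun b (wordFun e t)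

/-- The product of half maps prescribed by a binary word. -/
def wordMap (e : List Bool) : PSL2R := (e.map halfMap).prod

theorem halfFun_mem_Icc (b : Bool) {t : ℝ} (ht : t ∈ Set.Icc (0 : ℝ) 1) :
    halfFun b t ∈ Set.Icc (0 : ℝ) 1 := by
  obtain ⟨h0, h1⟩ := ht
  cases b
  · simp only [halfFun, Bool.false_eq_true, if_false]
    exact ⟨by positivity, by rw [div_le_one (by positivity)]; linarith⟩
  · simp only [halfFun, if_true]
    have : 0 < 2 - t := by linarith
    exact ⟨by positivity, by rw [div_le_one this]; linarith⟩

theorem halfFun_mono (b : Bool) {s t : ℝ} (hs : 0 ≤ s) (hst : s ≤ t) (ht : t ≤ 1) :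
    halfFun b s ≤ halfFun b t := by
  cases b
  · simp only [halfFun, Bool.false_eq_true, if_false]
    rw [div_le_div_iff₀ (by linarith) (by linarith)]
    linarith
  · simp only [halfFun, if_true]
    exact one_div_le_one_div_of_le (by linarith) (by linarith)

/-- The half maps are not uniform contractions of `[0, 1]`, each having a parabolic fixed point,
but they shorten an interval of length at most `1 / k` to one of length at most `1 / (k + 1)`. -/
theorem halfFun_sub_le (b : Bool) {s t k : ℝ} (hs : 0 ≤ s) (hst : s ≤ t) (ht : t ≤ 1)
    (hk : 0 < k) (h : t - s ≤ 1 / k) : halfFun b t - halfFun b s ≤ 1 / (k + 1) := by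
  rw [le_div_iff₀ hk] at h
  cases b
  · simp only [halfFun, Bool.false_eq_true, if_false]
    have h1 : 0 < 1 + s := by linarith
    have h2 : 0 < 1 + t := by linarith
    rw [div_sub_div _ _ h2.ne' h1.ne', div_le_div_iff₀ (by positivity) (by positivity)]
    nlinarith [mul_nonneg hs (hs.trans hst)]
  · simp only [halfFun, if_true]
    have h1 : 0 < 2 - s := by linarith
    have h2 : 0 < 2 - t := by linarith
    rw [div_sub_div _ _ h2.ne' h1.ne', div_le_div_iff₀ (by positivity) (by positivity)]
    nlinarith [mul_nonneg (sub_nonneg.2 ht) (sub_nonneg.2 (hst.trans ht))]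

theorem halfMap_smul_ofReal (b : Bool) {t : ℝ} (ht : t ∈ Set.Icc (0 : ℝ) 1) :
    halfMap b • ofReal t = ofReal (halfFun b t) := by
  cases b
  · exact leftMap_smul_ofReal ht.1
  · exact rightMap_smul_ofReal ht.2

theorem wordFun_mem_Icc (e : List Bool) {t : ℝ} (ht : t ∈ Set.Icc (0 : ℝ) 1) :
    wordFun e t ∈ Set.Icc (0 : ℝ) 1 := by
  induction e with
  | nil => exact ht
  | cons b e ih => exact halfFun_mem_Icc b ih

theorem wordFun_mono (e : List Bool) {s t : ℝ} (hs : 0 ≤ s) (hst : s ≤ t) (ht : t ≤ 1) :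
    wordFun e s ≤ wordFun e t := by
  induction e with
  | nil => exact hst
  | cons b e ih =>
    exact halfFun_mono b (wordFun_mem_Icc e ⟨hs, hst.trans ht⟩).1 ih
      (wordFun_mem_Icc e ⟨hs.trans hst, ht⟩).2

theorem wordFun_sub_le (e : List Bool) {s t : ℝ} (hs : 0 ≤ s) (hst : s ≤ t) (ht : t ≤ 1) :
    wordFun e t - wordFun e s ≤ 1 / (e.length + 1) := by
  induction e with
  | nil => simp [wordFun]; linarith
  | cons b e ih =>
    rw [List.length_cons]
    push_cast
    exact halfFun_sub_le b (wordFun_mem_Icc e ⟨hs, hst.trans ht⟩).1 (wordFun_mono e hs hst ht)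
      (wordFun_mem_Icc e ⟨hs.trans hst, ht⟩).2 (by positivity) ih

theorem wordFun_concat (e : List Bool) (b : Bool) (t : ℝ) :
    wordFun (e ++ [b]) t = wordFun e (halfFun b t) := by
  induction e with
  | nil => rfl
  | cons c e ih => exact congrArg (halfFun c) ih

theorem wordMap_concat (e : List Bool) (b : Bool) : wordMap (e ++ [b]) = wordMap e * halfMap b := by
  simp [wordMap]

theorem wordMap_smul_ofReal (e : List Bool) {t : ℝ} (ht : t ∈ Set.Icc (0 : ℝ) 1) :
    wordMap e • ofReal t = ofReal (wordFun e t) := by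
  induction e with
  | nil => simp [wordMap, wordFun]
  | cons b e ih =>
    rw [wordMap, List.map_cons, List.prod_cons, mul_smul]
    exact (congrArg (halfMap b • ·) ih).trans (halfMap_smul_ofReal b (wordFun_mem_Icc e ht))

/-- The question-mark function increases by `2⁻ⁿ` over a Farey interval of level `n`. -/
theorem exists_fareyValue_wordFun (e : List Bool) :
    ∃ y, FareyValue (wordFun e 0) y ∧ FareyValue (wordFun e 1) (y + 1 / 2 ^ e.length) := by
  induction e with
  | nil => exact ⟨0, .zero, by simpa [wordFun] using FareyValue.one⟩
  | cons b e ih =>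
    obtain ⟨y, h0, h1⟩ := ih
    have e1 : (1 : ℝ) / 2 ^ (b :: e).length = 1 / 2 ^ e.length / 2 := by
      rw [List.length_cons, pow_succ, div_div]
    rw [e1]
    cases b
    · exact ⟨_, h0.left, by rw [← add_div]; exact h1.left⟩
    · exact ⟨_, h0.right, by rw [← add_div, add_assoc]; exact h1.right⟩

/-! ### Equidistribution in one arc -/

/-- If `h` is within `ε` of `v` on `[0, 1]`, then `arcSum x n i h` is close to `2 ^ n * v`, because
all but boundedly many of the points lie in `[0, 1]`. -/
theorem abs_arcSum_sub_le (x : ProjLine) (n : ℕ) (i : Fin 3) {h : ProjLine → ℝ} {K v ε : ℝ}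
    (hε : 0 ≤ ε) (hK : ∀ y, |h y| ≤ K) (hv : |v| ≤ K)
    (hh : ∀ t ∈ Set.Icc (0 : ℝ) 1, |h (ofReal t) - v| ≤ ε) :
    |arcSum x n i h - 2 ^ n * v| ≤ 2 ^ n * ε + 6 * K := by
  have hK0 : 0 ≤ K := (abs_nonneg v).trans hv
  have hp : ∀ y, |h y - v| ≤ ε + 2 * K * outside y := fun y => by
    by_cases ho : outside y = 1
    · rw [ho]
      have := abs_sub (h y) v
      linarith [hK y]
    · obtain ⟨t, ht, rfl⟩ := exists_ofReal_of_outside_ne_one ho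
      have := mul_nonneg (mul_nonneg zero_le_two hK0) (outside_nonneg (ofReal t))
      linarith [hh t ht]
  have e1 : arcSum x n i h - 2 ^ n * v = ∑ g ∈ words n i, (h ((rot i)⁻¹ • g • x) - v) := by
    rw [Finset.sum_sub_distrib, Finset.sum_const, nsmul_eq_mul, card_words]; rfl
  have e2 : ∑ g ∈ words n i, (ε + 2 * K * outside ((rot i)⁻¹ • g • x)) =
      2 ^ n * ε + 2 * K * arcSum x n i outside := by
    rw [Finset.sum_add_distrib, Finset.sum_const, nsmul_eq_mul, card_words, ← Finset.mul_sum]; rfl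
  rw [e1]
  refine (Finset.abs_sum_le_sum_abs _ _).trans ((Finset.sum_le_sum fun g _ => hp _).trans ?_)
  rw [e2]
  nlinarith [arcSum_outside_le x n i]

section

variable {ν : Measure ℝ} [IsFiniteMeasure ν]

theorem measureReal_Ico_wordFun (hν : ∀ x y, FareyValue x y → ν.real (Set.Iio x) = y / 3)
    (e : List Bool) : ν.real (Set.Ico (wordFun e 0) (wordFun e 1)) = 1 / (3 * 2 ^ e.length) := by
  obtain ⟨y, h0, h1⟩ := exists_fareyValue_wordFun e
  have hd : Set.Ico (wordFun e 0) (wordFun e 1) =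
      Set.Iio (wordFun e 1) \ Set.Iio (wordFun e 0) := by
    ext t; simp
  rw [hd, measureReal_sdiff (Set.Iio_subset_Iio
    (wordFun_mono e le_rfl zero_le_one le_rfl)) measurableSet_Iio, hν _ _ h0, hν _ _ h1]
  field_simp
  ring

/-- Comparison of the orbit sum with the integral over one Farey interval, by subdividing it `m`
times: the oscillation `ε` of `h` on the intervals obtained controls the regular points, and each
of the `2 ^ m` intervals contributes a bounded number of exceptional points. -/
theorem abs_arcSum_sub_integral_le (hν : ∀ x y, FareyValue x y → ν.real (Set.Iio x) = y / 3)
    (x : ProjLine) (n : ℕ) {h : ProjLine → ℝ} (hc : Continuous h) {K ε : ℝ} (hε : 0 ≤ ε)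
    (hK : ∀ y, |h y| ≤ K) (m : ℕ) (i : Fin 3) (e : List Bool)
    (hosc : ∀ e' : List Bool, e'.length = e.length + m →
      ∀ s ∈ Set.Icc (wordFun e' 0) (wordFun e' 1), ∀ t ∈ Set.Icc (wordFun e' 0) (wordFun e' 1),
        |h (ofReal s) - h (ofReal t)| ≤ ε) :
    |arcSum x (n + m) i (fun y => h (wordMap e • y)) - 3 * 2 ^ (n + m + e.length) *
      ∫ t in Set.Ico (wordFun e 0) (wordFun e 1), h (ofReal t) ∂ν|
      ≤ 2 ^ (n + m) * (2 * ε) + 2 ^ m * (6 * K) := by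
  have hint : ∀ s, IntegrableOn (fun t => h (ofReal t)) s ν := fun s =>
    (Integrable.of_bound (hc.comp continuous_ofReal).aestronglyMeasurable K
      (ae_of_all _ fun t => hK _)).integrableOn
  induction m generalizing i e with
  | zero =>
    have h0 : wordFun e 0 ∈ Set.Icc (wordFun e 0) (wordFun e 1) :=
      Set.left_mem_Icc.2 (wordFun_mono e le_rfl zero_le_one le_rfl)
    set v := h (ofReal (wordFun e 0)) with hv
    have h1 := abs_arcSum_sub_le x n i (h := fun y => h (wordMap e • y)) (v := v) hε
      (fun y => hK _) (hK _) (fun t ht => by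
        rw [wordMap_smul_ofReal e ht]
        exact hosc e rfl _ ⟨wordFun_mono e le_rfl ht.1 ht.2, wordFun_mono e ht.1 ht.2 le_rfl⟩ _ h0)
    have h2 : |(∫ t in Set.Ico (wordFun e 0) (wordFun e 1), h (ofReal t) ∂ν) -
        v * (1 / (3 * 2 ^ e.length))| ≤ ε * (1 / (3 * 2 ^ e.length)) := by
      rw [← measureReal_Ico_wordFun hν e]
      have e1 : v * ν.real (Set.Ico (wordFun e 0) (wordFun e 1)) =
          ∫ t in Set.Ico (wordFun e 0) (wordFun e 1), v ∂ν := by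
        rw [setIntegral_const, smul_eq_mul, mul_comm]
      rw [e1, ← integral_sub (hint _) (integrable_const v)]
      exact norm_setIntegral_le_of_norm_le_const (f := fun t => h (ofReal t) - v)
        (measure_lt_top _ _) fun t ht => hosc e rfl t (Set.Ico_subset_Icc_self ht) _ h0
    have hp : (0 : ℝ) < 2 ^ e.length := by positivity
    set I := ∫ t in Set.Ico (wordFun e 0) (wordFun e 1), h (ofReal t) ∂ν
    have h3 : |2 ^ n * v - 3 * 2 ^ (n + e.length) * I| ≤ 2 ^ n * ε := by
      have e2 : 2 ^ n * v - 3 * 2 ^ (n + e.length) * I =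
          -(3 * 2 ^ (n + e.length) * (I - v * (1 / (3 * 2 ^ e.length)))) := by
        rw [pow_add]; field_simp; ring
      rw [e2, abs_neg, abs_mul, abs_of_pos (by positivity)]
      refine (mul_le_mul_of_nonneg_left h2 (by positivity)).trans (le_of_eq ?_)
      rw [pow_add]; field_simp
    have h4 := abs_sub_le (arcSum x n i (fun y => h (wordMap e • y))) (2 ^ n * v)
      (3 * 2 ^ (n + e.length) * I)
    simp only [add_zero, pow_zero, one_mul]
    linarith
  | succ m ih =>
    have hl : ∀ b, (e ++ [b]).length = e.length + 1 := fun b => by simp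
    have ih' := fun b j => ih j (e ++ [b]) fun e' he' => hosc e' (by rw [he', hl]; omega)
    have i0 := ih' false (i + 1)
    have i1 := ih' true (i + 2)
    have w0 : ∀ y : ProjLine, wordMap (e ++ [false]) • y = wordMap e • leftMap • y := fun y => by
      rw [wordMap_concat, mul_smul]; rfl
    have w1 : ∀ y : ProjLine, wordMap (e ++ [true]) • y = wordMap e • rightMap • y := fun y => by
      rw [wordMap_concat, mul_smul]; rfl
    have f00 : wordFun (e ++ [false]) 0 = wordFun e 0 := by
      rw [wordFun_concat]; simp [halfFun]
    have f01 : wordFun (e ++ [false]) 1 = wordFun e (1 / 2) := by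
      rw [wordFun_concat]; norm_num [halfFun]
    have f10 : wordFun (e ++ [true]) 0 = wordFun e (1 / 2) := by
      rw [wordFun_concat]; norm_num [halfFun]
    have f11 : wordFun (e ++ [true]) 1 = wordFun e 1 := by
      rw [wordFun_concat]; norm_num [halfFun]
    simp only [w0, f00, f01, hl] at i0
    simp only [w1, f10, f11, hl] at i1
    rw [← add_assoc, arcSum_succ]
    have hsplit : ∫ t in Set.Ico (wordFun e 0) (wordFun e 1), h (ofReal t) ∂ν =
        (∫ t in Set.Ico (wordFun e 0) (wordFun e (1 / 2)), h (ofReal t) ∂ν) +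
        ∫ t in Set.Ico (wordFun e (1 / 2)) (wordFun e 1), h (ofReal t) ∂ν := by
      rw [← setIntegral_union (Set.Ico_disjoint_Ico_same) measurableSet_Ico (hint _) (hint _),
        Set.Ico_union_Ico_eq_Ico (wordFun_mono e le_rfl (by norm_num) (by norm_num))
          (wordFun_mono e (by norm_num) (by norm_num) le_rfl)]
    rw [hsplit]
    have ep : n + m + 1 + e.length = n + m + (e.length + 1) := by omega
    rw [ep, mul_add, add_sub_add_comm]
    refine (abs_add_le _ _).trans ((add_le_add i0 i1).trans (le_of_eq ?_))
    rw [pow_succ, pow_succ]; ring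

/-- The orbit points in one arc become equidistributed. -/
theorem tendsto_arcSum (hν : ∀ x y, FareyValue x y → ν.real (Set.Iio x) = y / 3) (x : ProjLine)
    (i : Fin 3) {h : ProjLine → ℝ} (hc : Continuous h) :
    Tendsto (fun n => arcSum x n i h / 2 ^ n) atTop
      (𝓝 (3 * ∫ t in Set.Ico (0 : ℝ) 1, h (ofReal t) ∂ν)) := by
  obtain ⟨K, hK0, hK⟩ := exists_abs_le_of_continuous hc
  rw [Metric.tendsto_atTop]
  intro δ hδ
  obtain ⟨η, hη, hu⟩ := Metric.uniformContinuousOn_iff_le.1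
    (isCompact_Icc.uniformContinuousOn_of_continuous (s := Set.Icc (0 : ℝ) 1)
      (hc.comp continuous_ofReal).continuousOn) (δ / 4) (by positivity)
  obtain ⟨m, hm⟩ := exists_nat_one_div_lt hη
  -- The exceptional points contribute `2 ^ m * 6 * K` out of `2 ^ (n + m)`, so `6 * K / 2 ^ n`
  -- has to be less than `δ / 2`.
  obtain ⟨N, hN⟩ := exists_pow_lt_of_lt_one (show 0 < δ / (12 * K + 1) by positivity)
    (show (1 / 2 : ℝ) < 1 by norm_num)
  refine ⟨N + m, fun n' hn' => ?_⟩
  obtain ⟨k, rfl⟩ := Nat.exists_eq_add_of_le hn'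
  have h1 := abs_arcSum_sub_integral_le hν x (N + k) hc (ε := δ / 4) (by positivity) hK m i []
    (fun e' he' s hs t ht => by
      have h0 := (wordFun_mem_Icc e' (t := 0) (by simp)).1
      have h1 := (wordFun_mem_Icc e' (t := 1) (by simp)).2
      refine hu s ⟨h0.trans hs.1, hs.2.trans h1⟩ t ⟨h0.trans ht.1, ht.2.trans h1⟩ ?_
      have h2 := wordFun_sub_le e' le_rfl zero_le_one le_rfl
      rw [he', List.length_nil, zero_add] at h2
      rw [Real.dist_eq, abs_le]
      constructor <;> linarith [hs.1, hs.2, ht.1, ht.2])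
  have e1 : N + m + k = N + k + m := by omega
  rw [e1]
  simp only [wordMap, wordFun, List.map_nil, List.prod_nil, one_smul, List.length_nil,
    add_zero] at h1
  have hp : (0 : ℝ) < 2 ^ (N + k + m) := by positivity
  rw [Real.dist_eq, ← mul_lt_mul_iff_right₀ hp, ← abs_of_pos hp, ← abs_mul, abs_of_pos hp, mul_sub,
    mul_div_cancel₀ _ hp.ne', mul_left_comm, ← mul_assoc]
  refine h1.trans_lt ?_
  rw [one_div_pow, div_lt_div_iff₀ (by positivity) (by positivity), one_mul] at hN
  have hk : (1 : ℝ) ≤ 2 ^ k := one_le_pow₀ one_le_two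
  have h2 : 12 * K < δ * 2 ^ (N + k) := by
    rw [pow_add]
    have : 0 < δ * 2 ^ N := by positivity
    nlinarith
  have h3 : 2 ^ (N + k + m) * δ = 2 ^ m * (δ * 2 ^ (N + k)) := by rw [pow_add]; ring
  have h4 : (0 : ℝ) < 2 ^ m := by positivity
  rw [show 2 ^ (N + k + m) * (2 * (δ / 4)) = 2 ^ (N + k + m) * δ / 2 by ring]
  nlinarith [mul_lt_mul_of_pos_left h2 h4]

end

/-! ### Assembling the three arcs -/

/-- Equidistribution in the arc `rot i • [0, 1]`, in terms of the affine coordinate: `κ` is the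
inverse of the rotation on the part `D` of the real line inside the arc. -/
theorem tendsto_arcSum_rot (x : ProjLine) (i : Fin 3) {f : ProjLine → ℝ} (hf : Continuous f)
    {D : Set ℝ} (hD : MeasurableSet D) {κ : ℝ → ℝ} (hκ : Measurable κ)
    (hmem : ∀ t ∈ D, κ t ∈ Set.Ico (0 : ℝ) 1) (hrot : ∀ t ∈ D, rot i • ofReal (κ t) = ofReal t)
    (hν : ∀ x y, FareyValue x y → lineMeasure (D ∩ κ ⁻¹' Set.Iio x) = ENNReal.ofReal (y / 3)) :
    Tendsto (fun n => arcSum x n i (fun y => f (rot i • y)) / 2 ^ n) atTop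
      (𝓝 (3 * ∫ t in D, f (ofReal t) ∂lineMeasure)) := by
  have hc : Continuous (fun y => f (rot i • y)) := hf.comp (continuous_smul_projLine _)
  have h := tendsto_arcSum (ν := (lineMeasure.restrict D).map κ) (fun x y hxy => by
    rw [Measure.real, Measure.map_apply hκ measurableSet_Iio,
      Measure.restrict_apply (hκ measurableSet_Iio), Set.inter_comm, hν x y hxy,
      ENNReal.toReal_ofReal (div_nonneg hxy.value_mem_Icc.1 zero_le_three)]) x i hc
  convert h using 3
  rw [setIntegral_map (f := fun t => f (rot i • ofReal t)) measurableSet_Ico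
    (hc.comp continuous_ofReal).aestronglyMeasurable hκ.aemeasurable,
    Measure.restrict_restrict (hκ measurableSet_Ico),
    Set.inter_eq_right.2 (show D ⊆ κ ⁻¹' Set.Ico 0 1 from hmem)]
  exact setIntegral_congr_fun hD fun t ht => by simp only [hrot t ht]

theorem tendsto_arcSum_zero (x : ProjLine) {f : ProjLine → ℝ} (hf : Continuous f) :
    Tendsto (fun n => arcSum x n 0 (fun y => f (rot 0 • y)) / 2 ^ n) atTop
      (𝓝 (3 * ∫ t in Set.Ico 0 1, f (ofReal t) ∂lineMeasure)) := by
  refine tendsto_arcSum_rot x 0 hf measurableSet_Ico measurable_id (fun t ht => ht)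
    (fun t _ => by rw [rot_zero, one_smul, id]) fun z y h => ?_
  have e : Set.Ico (0 : ℝ) 1 ∩ id ⁻¹' Set.Iio z = Set.Ico 0 z := by
    ext t
    simp only [Set.mem_inter_iff, Set.mem_Ico, Set.mem_preimage, Set.mem_Iio, id]
    have := h.mem_Icc.2
    constructor
    · rintro ⟨⟨h1, _⟩, h2⟩; exact ⟨h1, h2⟩
    · rintro ⟨h1, h2⟩; exact ⟨⟨h1, by linarith⟩, h2⟩
  rw [e, lineMeasure_Ico, h.extQuestionMark_eq, extQuestionMark_zero]
  congr 1; ring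

theorem tendsto_arcSum_one (x : ProjLine) {f : ProjLine → ℝ} (hf : Continuous f) :
    Tendsto (fun n => arcSum x n 1 (fun y => f (rot 1 • y)) / 2 ^ n) atTop
      (𝓝 (3 * ∫ t in Set.Ici 1, f (ofReal t) ∂lineMeasure)) := by
  have hmem : ∀ t ∈ Set.Ici (1 : ℝ), 1 - 1 / t ∈ Set.Ico (0 : ℝ) 1 := fun t ht => by
    have ht : 1 ≤ t := ht
    have h1 : 1 / t ≤ 1 := by rw [div_le_one (by linarith)]; exact ht
    have h2 : 0 < 1 / t := by positivity
    exact ⟨by linarith, by linarith⟩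
  refine tendsto_arcSum_rot x 1 hf measurableSet_Ici (κ := fun t => 1 - 1 / t) (by fun_prop) hmem
    (fun t ht => ?_) fun z y h => ?_
  · rw [rot_one_smul_ofReal (hmem t ht).2.ne, sub_sub_cancel, one_div_one_div]
  have h1 := FareyValue.one.extQuestionMark_eq
  rcases h.mem_Icc.2.lt_or_eq with hz | hz
  · have e : Set.Ici (1 : ℝ) ∩ (fun t => 1 - 1 / t) ⁻¹' Set.Iio z = Set.Ico 1 (1 / (1 - z)) := by
      ext t
      simp only [Set.mem_inter_iff, Set.mem_Ici, Set.mem_preimage, Set.mem_Iio, Set.mem_Ico]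
      refine and_congr_right fun ht => ?_
      rw [sub_lt_comm, lt_one_div (by linarith) (by linarith)]
    rw [e, lineMeasure_Ico, h.extQuestionMark_rot_one hz, h1]
    congr 1; ring
  · have e : Set.Ici (1 : ℝ) ∩ (fun t => 1 - 1 / t) ⁻¹' Set.Iio z = Set.Ici 1 :=
      Set.inter_eq_left.2 fun t ht => hz ▸ (hmem t ht).2
    rw [e, lineMeasure_Ici, h1, h.value_eq_one hz]
    norm_num

theorem tendsto_arcSum_two (x : ProjLine) {f : ProjLine → ℝ} (hf : Continuous f) :
    Tendsto (fun n => arcSum x n 2 (fun y => f (rot 2 • y)) / 2 ^ n) atTop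
      (𝓝 (3 * ∫ t in Set.Iio 0, f (ofReal t) ∂lineMeasure)) := by
  have hpos : ∀ t ∈ Set.Iio (0 : ℝ), 0 < 1 / (1 - t) := fun t ht => by
    have ht : t < 0 := ht
    exact one_div_pos.2 (by linarith)
  refine tendsto_arcSum_rot x 2 hf measurableSet_Iio (κ := fun t => 1 / (1 - t)) (by fun_prop)
    (fun t ht => ⟨(hpos t ht).le, ?_⟩) (fun t ht => ?_) fun z y h => ?_
  · have ht : t < 0 := ht
    rw [div_lt_one (by linarith)]; linarith
  · rw [rot_two_smul_ofReal (hpos t ht).ne', one_div_one_div, sub_sub_cancel]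
  rcases h.mem_Icc.1.eq_or_lt with hz | hz
  · have e : Set.Iio (0 : ℝ) ∩ (fun t => 1 / (1 - t)) ⁻¹' Set.Iio z = ∅ :=
      Set.eq_empty_of_forall_notMem fun t ht => (hz ▸ hpos t ht.1).not_gt ht.2
    rw [e, measure_empty, h.value_eq_zero hz.symm]
    simp
  · have e : Set.Iio (0 : ℝ) ∩ (fun t => 1 / (1 - t)) ⁻¹' Set.Iio z = Set.Iio (1 - 1 / z) := by
      ext t
      simp only [Set.mem_inter_iff, Set.mem_preimage, Set.mem_Iio]
      have h1 : 1 ≤ 1 / z := by rw [le_div_iff₀ hz]; linarith [h.mem_Icc.2]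
      constructor
      · rintro ⟨ht, h2⟩
        rw [one_div_lt (by linarith) hz] at h2
        linarith
      · intro ht
        refine ⟨by linarith, ?_⟩
        rw [one_div_lt (by linarith) hz]
        linarith
    rw [e, lineMeasure_Iio, h.extQuestionMark_rot_two hz]

theorem tendsto_orbitSum (x : ProjLine) {f : ProjLine → ℝ} (hf : Continuous f) :
    Tendsto (fun n : ℕ => orbitSum n f x / ((sphere n).card : ℝ)) atTop
      (𝓝 (∫ y, f y ∂minkowskiMeasure)) := by
  rw [← tendsto_add_atTop_iff_nat 1]
  obtain ⟨K, -, hK⟩ := exists_abs_le_of_continuous hf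
  have hint : ∀ s, IntegrableOn (fun t => f (ofReal t)) s lineMeasure := fun s =>
    (Integrable.of_bound (hf.comp continuous_ofReal).aestronglyMeasurable K
      (ae_of_all _ fun t => hK _)).integrableOn
  have hI : ∫ y, f y ∂minkowskiMeasure = (3 * (∫ t in Set.Ico 0 1, f (ofReal t) ∂lineMeasure) +
      3 * (∫ t in Set.Ici 1, f (ofReal t) ∂lineMeasure) +
      3 * ∫ t in Set.Iio 0, f (ofReal t) ∂lineMeasure) / 3 := by
    have e1 : Set.Ico (0 : ℝ) 1 ∪ Set.Ici 1 = Set.Ici 0 := Set.Ico_union_Ici_eq_Ici zero_le_one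
    have h1 := setIntegral_union (Set.disjoint_left.2 fun t ht ht' => ht.2.not_ge ht')
      measurableSet_Ici (hint (Set.Ico 0 1)) (hint (Set.Ici 1))
    have h2 := integral_add_compl (measurableSet_Ici (a := (0 : ℝ)))
      (integrableOn_univ.1 (hint Set.univ))
    rw [Set.compl_Ici] at h2
    rw [minkowskiMeasure_eq_map, measurableEmbedding_ofReal.integral_map, ← h2, ← e1, h1]
    ring
  rw [hI]
  refine ((((tendsto_arcSum_zero x hf).add (tendsto_arcSum_one x hf)).add
    (tendsto_arcSum_two x hf)).div_const 3).congr fun n => ?_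
  rw [orbitSum_succ, card_sphere_succ, Fin.sum_univ_three]
  field_simp

end Farey

theorem theorem2p2 :
    IsProbabilityMeasure Farey.minkowskiMeasure ∧
    (∀ s t : ℝ, s ≤ t → Farey.minkowskiMeasure (Farey.ofReal '' Set.Ico s t)
      = ENNReal.ofReal (Farey.extQuestionMark t - Farey.extQuestionMark s)) ∧
    ∀ (x : Farey.ProjLine) (f : Farey.ProjLine → ℝ), Continuous f →
      Tendsto (fun n : ℕ => Farey.orbitSum n f x / ((Farey.sphere n).card : ℝ)) atTop
        (𝓝 (∫ y, f y ∂Farey.minkowskiMeasure)) :=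
  ⟨Farey.isProbabilityMeasure_minkowskiMeasure,
    fun s t _ => Farey.minkowskiMeasure_image_Ico s t,
    fun x _ hf => Farey.tendsto_orbitSum x hf⟩
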